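/- Call a finite measure space resonant if it is either nonatomic, or completely atomic with all atoms of equal measure (an atom is a measurable set of positive measure that does not split into two measurable sets of positive measure; completely atomic means that every measurable set of positive measure contains an atom). For a measurable function $f$ on a measure space $(X,\mu)$ let $\lambda_f(s)=\mu(\{x\in X:|f(x)|>s\})$ be its distribution function and $f^*(t)=\inf\{s>0:\lambda_f(s)\le t\}$ its nonincreasing rearrangement. Theorem. Let $(X,\mu)$ and $(Y,\nu)$ be two finite resonant measure spaces and let $f:X\to[0,\infty)$ and $g:Y\to[0,\infty)$ be measurable functions satisfying $\|f\|_{L^1(\mu)}=\|g\|_{L^1(\nu)}$ and $$\int_0^t f^*(s)\,ds\le\int_0^t\lambda_g(s)\,ds\qquad\text{for all } t>0.$$ If $\nu$ is completely atomic, assume moreover that $f(x)$ belongs to the range $\{\nu(B):B\subset Y\text{ measurable}\}$ of $\nu$ for $\mu$-a.e. $x$; if $\mu$ is completely atomic, assume moreover that $g(y)$ belongs to the range $\{\mu(A):A\subset X\text{ measurable}\}$ of $\mu$ for $\nu$-a.e. $y$. Then there exists a measurable set $E\subset X\times Y$ such that $$\int_Y\chi_E(x,y)\,d\nu(y)=f(x)\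 \text{ for }\mu\text{-a.e. }x\in X\qquad\text{and}\qquad \int_X\chi_E(x,y)\,d\mu(x)=g(y)\ \text{ for }\nu\text{-a.e. }y\in Y.$$ -/

import Mathlib

open MeasureTheory
open scoped ENNReal

namespace Resonant

variable {X Y : Type*} [MeasurableSpace X] [MeasurableSpace Y]

/-- `A` is an atom of `μ`: a measurable set of positive measure which cannot be split into two
measurable pieces of positive measure. -/
def IsAtomOf (μ : Measure X) (A : Set X) : Prop :=
  MeasurableSet A ∧ 0 < μ A ∧ ∀ B ⊆ A, MeasurableSet B → μ B = 0 ∨ μ (A \ B) = 0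

/-- `μ` is nonatomic: it has no atoms. (This is stronger than `NoAtoms`, which only speaks about
singletons.) -/
def IsNonatomic (μ : Measure X) : Prop :=
  ∀ A : Set X, ¬ IsAtomOf μ A

/-- `μ` is completely atomic (every measurable set of positive measure contains an atom)
and all its atoms have equal measure. -/
def IsEquiatomic (μ : Measure X) : Prop :=
  (∀ A : Set X, MeasurableSet A → 0 < μ A → ∃ B ⊆ A, IsAtomOf μ B) ∧
    ∀ A B : Set X, IsAtomOf μ A → IsAtomOf μ B → μ A = μ B

/-- Resonant measure: nonatomic, or completely atomic with all atoms of equal measure. -/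
def IsResonant (μ : Measure X) : Prop :=
  IsNonatomic μ ∨ IsEquiatomic μ

/-- The distribution function `λ_f(s) = μ {x : |f x| > s}`. -/
def distribution (μ : Measure X) (f : X → ℝ) (s : ℝ) : ℝ≥0∞ :=
  μ {x | s < |f x|}

/-- The nonincreasing rearrangement `f^*(t) = inf {s > 0 : λ_f(s) ≤ t}`, the infimum being taken
in `[0, ∞]` (so that the infimum of the empty set is `∞`). -/
noncomputable def rearrangement (μ : Measure X) (f : X → ℝ) (t : ℝ) : ℝ≥0∞ :=
  sInf (ENNReal.ofReal '' {s : ℝ | 0 < s ∧ distribution μ f s ≤ ENNReal.ofReal t})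

/-- The vertical cross section `v_E(x) = ∫ χ_E(x, y) dν(y)`. -/
noncomputable def vertSection (ν : Measure Y) (E : Set (X × Y)) (x : X) : ℝ≥0∞ :=
  ∫⁻ y, E.indicator (fun _ => (1 : ℝ≥0∞)) (x, y) ∂ν

/-- The horizontal cross section `h_E(y) = ∫ χ_E(x, y) dμ(x)`. -/
noncomputable def horizSection (μ : Measure X) (E : Set (X × Y)) (y : Y) : ℝ≥0∞ :=
  ∫⁻ x, E.indicator (fun _ => (1 : ℝ≥0∞)) (x, y) ∂μ

/-- The real number `r` is a value of the measure `μ`. -/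
def IsMeasureValue (μ : Measure X) (r : ℝ) : Prop :=
  ∃ A : Set X, MeasurableSet A ∧ μ A = ENNReal.ofReal r

end Resonant

/-! The hypothesis on rearrangements is a continuous Gale–Ryser condition. By the layer-cake formula
it yields the cut inequality `SectionBound`, which is exactly the feasibility condition for a
fractional solution: a function `k` with values in `[0, 1]` and marginals `f` and `g`.

Integrating the cut inequality over level sets gives `∫ f u + ∫ g v ≤ ∫ (u + v)⁺`
(`SectionBound.integral_mul_add_le`). Hahn–Banach then extends the functional `u + v ↦ ∫ f u + ∫ g
v` to `L²(μ × ν)` under the sublinear bound `φ ↦ ∫ φ⁺`, and Riesz representation turns such a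
functional into a coupling `k`. The admissible functionals form a compact convex set, so there is an
extreme one (`exists_extremalCoupling`).

Extremality forces `k` to be almost everywhere `0` or `1`, and then `{k > 1/2}` is the required set.
Otherwise mass could be shifted around the four corners of rectangles on which `k` is fractional. If
both measures are nonatomic, almost no such rectangle exists, and a Fubini argument makes the
fractional set null. An equiatomic measure is replaced by a finite set of equal point masses. There
the range hypotheses give integral row or column sums, so a row or column with one fractional entry
has a second, and this again produces a forbidden rectangle or, when both sides are finite, a
forbidden weight found by counting dimensions. -/

namespace Resonant

variable {X Y : Type*} [MeasurableSpace X] [MeasurableSpace Y]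

/-! ### From rearrangements to the section inequality -/

/-- The section inequality: for all measurable `A` and `B`, the mass of `f` over `A` is at most
`μ A * ν B` plus the mass of `g` off `B`. -/
def SectionBound (μ : Measure X) (ν : Measure Y) (f : X → ℝ) (g : Y → ℝ) : Prop :=
  ∀ (A : Set X) (B : Set Y), MeasurableSet A → MeasurableSet B →
    ∫⁻ x in A, ENNReal.ofReal (f x) ∂μ ≤ μ A * ν B + ∫⁻ y in Bᶜ, ENNReal.ofReal (g y) ∂ν

/-- Every `s` admissible in the infimum confines the superlevel set to `(0, s]`, because the
distribution function is nonincreasing. -/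
lemma volume_superlevel_distribution_le_rearrangement (μ : Measure X) (f : X → ℝ) (t : ℝ) :
    volume (Set.Ioi 0 ∩ {s : ℝ | ENNReal.ofReal t < distribution μ f s}) ≤ rearrangement μ f t := by
  refine le_sInf ?_
  rintro _ ⟨s, ⟨hs, hst⟩, rfl⟩
  have : Set.Ioi 0 ∩ {s : ℝ | ENNReal.ofReal t < distribution μ f s} ⊆ Set.Ioc 0 s := by
    rintro r ⟨hr, hrt⟩
    refine ⟨hr, ?_⟩
    by_contra! h
    refine absurd (hrt.trans_le ?_) (not_lt.2 hst)
    exact measure_mono fun x hx => lt_trans h hx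
  refine (measure_mono this).trans ?_
  simp

lemma antitone_distribution (μ : Measure X) (f : X → ℝ) : Antitone (distribution μ f) :=
  fun _ _ h => measure_mono fun _ hx => lt_of_le_of_lt h hx

/-- By layer cake the left side integrates `μ (A ∩ {f > s})`, which is at most `min (μ A) (λ_f s)`.
That minimum is the length of the `τ` in `(0, μ A]` with `τ < λ_f s`, up to an endpoint, and Tonelli
exchanges `s` and `τ`. -/
lemma setLIntegral_le_lintegral_rearrangement (μ : Measure X) [IsFiniteMeasure μ] {f : X → ℝ}
    (hf : Measurable f) (hf0 : ∀ x, 0 ≤ f x) (A : Set X) :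
    ∫⁻ x in A, ENNReal.ofReal (f x) ∂μ ≤
      ∫⁻ t in Set.Ioc 0 (μ A).toReal, rearrangement μ f t := by
  set t := (μ A).toReal
  have ht : μ A = ENNReal.ofReal t := (ENNReal.ofReal_toReal (measure_ne_top μ A)).symm
  have hS : MeasurableSet {p : ℝ × ℝ | ENNReal.ofReal p.2 < distribution μ f p.1} :=
    measurableSet_lt (by fun_prop) ((antitone_distribution μ f).measurable.comp measurable_fst)
  calc ∫⁻ x in A, ENNReal.ofReal (f x) ∂μ
      = ∫⁻ s in Set.Ioi 0, μ.restrict A {a | s < f a} :=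
        lintegral_eq_lintegral_meas_lt _ (ae_of_all _ hf0) hf.aemeasurable
    _ ≤ ∫⁻ s in Set.Ioi (0 : ℝ), ∫⁻ τ in Set.Ioc 0 t,
          {p : ℝ × ℝ | ENNReal.ofReal p.2 < distribution μ f p.1}.indicator 1 (s, τ) := by
        refine lintegral_mono fun s => ?_
        have h1 : μ.restrict A {a | s < f a} ≤ min (ENNReal.ofReal t) (distribution μ f s) := by
          refine le_min ?_ ?_
          · rw [← ht]
            exact (measure_mono (Set.subset_univ _)).trans (by simp)
          · refine (Measure.restrict_apply_le _ _).trans (measure_mono fun x hx => ?_)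
            exact lt_of_lt_of_le (show s < f x from hx) (le_abs_self _)
        refine h1.trans ?_
        have hd : distribution μ f s = ENNReal.ofReal (distribution μ f s).toReal :=
          (ENNReal.ofReal_toReal (measure_ne_top μ _)).symm
        set d := (distribution μ f s).toReal
        have h2 : ∀ τ, {p : ℝ × ℝ | ENNReal.ofReal p.2 < distribution μ f p.1}.indicator
            (1 : ℝ × ℝ → ℝ≥0∞) (s, τ) = {τ : ℝ | ENNReal.ofReal τ < distribution μ f s}.indicator
              1 τ := fun τ => rfl
        simp_rw [h2]
        rw [lintegral_indicator_one (measurableSet_lt (by fun_prop) measurable_const),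
          Measure.restrict_apply (measurableSet_lt (by fun_prop) measurable_const)]
        have h3 : Set.Ioo 0 (min t d) ⊆
            {τ : ℝ | ENNReal.ofReal τ < distribution μ f s} ∩ Set.Ioc 0 t := by
          rintro τ ⟨h0, hτ⟩
          refine ⟨?_, h0, (hτ.trans_le (min_le_left _ _)).le⟩
          change ENNReal.ofReal τ < distribution μ f s
          rw [hd]
          exact (ENNReal.ofReal_lt_ofReal_iff (h0.trans (hτ.trans_le (min_le_right _ _)))).2
            (hτ.trans_le (min_le_right _ _))
        refine le_trans ?_ (measure_mono h3)
        rw [Real.volume_Ioo, sub_zero, hd]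
        rcases min_choice t d with h | h <;> rw [h] <;> simp
    _ = ∫⁻ τ in Set.Ioc 0 t, ∫⁻ s in Set.Ioi (0 : ℝ),
          {p : ℝ × ℝ | ENNReal.ofReal p.2 < distribution μ f p.1}.indicator 1 (s, τ) :=
        lintegral_lintegral_swap ((measurable_one.indicator hS).aemeasurable)
    _ ≤ ∫⁻ τ in Set.Ioc 0 t, rearrangement μ f τ := by
        refine lintegral_mono fun τ => le_trans (le_of_eq ?_)
          (volume_superlevel_distribution_le_rearrangement μ f τ)
        have h2 : ∀ s, {p : ℝ × ℝ | ENNReal.ofReal p.2 < distribution μ f p.1}.indicator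
            (1 : ℝ × ℝ → ℝ≥0∞) (s, τ) = {s : ℝ | ENNReal.ofReal τ < distribution μ f s}.indicator
              1 s := fun τ => rfl
        have h3 : MeasurableSet {s : ℝ | ENNReal.ofReal τ < distribution μ f s} :=
          measurableSet_lt measurable_const (antitone_distribution μ f).measurable
        simp_rw [h2]
        rw [lintegral_indicator_one h3, Measure.restrict_apply h3, Set.inter_comm]

/-- Split `{g > s}` along `B`: the part inside costs at most `ν B` for each `s`, and the part
outside integrates to at most the mass of `g` off `B`. -/
lemma lintegral_distribution_le (ν : Measure Y) {g : Y → ℝ} (hg : Measurable g)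
    (hg0 : ∀ y, 0 ≤ g y) (B : Set Y) (t : ℝ) :
    ∫⁻ s in Set.Ioc 0 t, distribution ν g s ≤
      ENNReal.ofReal t * ν B + ∫⁻ y in Bᶜ, ENNReal.ofReal (g y) ∂ν := by
  calc ∫⁻ s in Set.Ioc 0 t, distribution ν g s
      ≤ ∫⁻ s in Set.Ioc 0 t, (ν B + ν.restrict Bᶜ {y | s < g y}) := by
        refine lintegral_mono fun s => ?_
        rw [Measure.restrict_apply (measurableSet_lt measurable_const hg)]
        refine le_trans (measure_mono fun y hy => ?_) (measure_union_le _ _)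
        by_cases h : y ∈ B
        · exact Or.inl h
        · exact Or.inr ⟨by simpa [abs_of_nonneg (hg0 y)] using hy, h⟩
    _ = ENNReal.ofReal t * ν B + ∫⁻ s in Set.Ioc 0 t, ν.restrict Bᶜ {y | s < g y} := by
        rw [lintegral_add_left measurable_const, setLIntegral_const, Real.volume_Ioc, sub_zero,
          mul_comm]
    _ ≤ _ := by
        gcongr
        rw [lintegral_eq_lintegral_meas_lt _ (ae_of_all _ hg0) hg.aemeasurable]
        exact lintegral_mono_set Set.Ioc_subset_Ioi_self

lemma sectionBound_of_rearrangement_le (μ : Measure X) (ν : Measure Y) [IsFiniteMeasure μ]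
    {f : X → ℝ} {g : Y → ℝ} (hf : Measurable f) (hg : Measurable g)
    (hf0 : ∀ x, 0 ≤ f x) (hg0 : ∀ y, 0 ≤ g y)
    (h : ∀ t : ℝ, 0 < t →
      ∫⁻ s in Set.Ioc 0 t, rearrangement μ f s ≤ ∫⁻ s in Set.Ioc 0 t, distribution ν g s) :
    SectionBound μ ν f g := by
  intro A B _ _
  rcases eq_or_ne (μ A) 0 with h0 | h0
  · simp [Measure.restrict_eq_zero.2 h0]
  · refine (setLIntegral_le_lintegral_rearrangement μ hf hf0 A).trans
      ((h _ (ENNReal.toReal_pos h0 (measure_ne_top μ A))).trans ?_)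
    refine (lintegral_distribution_le ν hg hg0 B _).trans ?_
    rw [ENNReal.ofReal_toReal (measure_ne_top μ A)]

lemma SectionBound.lintegral_ne_top {μ : Measure X} {ν : Measure Y} [IsFiniteMeasure μ]
    [IsFiniteMeasure ν] {f : X → ℝ} {g : Y → ℝ} (h : SectionBound μ ν f g) :
    ∫⁻ x, ENNReal.ofReal (f x) ∂μ ≠ ∞ := by
  have := h Set.univ Set.univ .univ .univ
  simp only [Measure.restrict_univ, Set.compl_univ, Measure.restrict_empty,
    lintegral_zero_measure, add_zero] at this
  exact (this.trans_lt (ENNReal.mul_lt_top (measure_lt_top _ _) (measure_lt_top _ _))).ne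

/-- Add the mass of `f` off `A` to both sides, replace the total mass of `f` by that of `g`, and
cancel the mass of `g` off `B`. This lets the two factors exchange roles in the mixed case. -/
lemma SectionBound.symm {μ : Measure X} {ν : Measure Y} [IsFiniteMeasure μ]
    [IsFiniteMeasure ν] {f : X → ℝ} {g : Y → ℝ} (h : SectionBound μ ν f g)
    (hfg : ∫⁻ x, ENNReal.ofReal (f x) ∂μ = ∫⁻ y, ENNReal.ofReal (g y) ∂ν) :
    SectionBound ν μ g f := by
  intro B A hB hA
  have h1 := h A B hA hB
  have hf := h.lintegral_ne_top
  rw [← lintegral_add_compl (fun x => ENNReal.ofReal (f x)) hA,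
    ← lintegral_add_compl (fun y => ENNReal.ofReal (g y)) hB] at hfg
  have h2 : ∫⁻ y in Bᶜ, ENNReal.ofReal (g y) ∂ν ≠ ∞ := by
    rw [← lintegral_add_compl (fun x => ENNReal.ofReal (f x)) hA, hfg] at hf
    exact (ENNReal.add_ne_top.1 hf).2
  refine (ENNReal.add_le_add_iff_right h2).1 ?_
  rw [← hfg, mul_comm]
  calc _ ≤ μ A * ν B + ∫⁻ y in Bᶜ, ENNReal.ofReal (g y) ∂ν
        + ∫⁻ x in Aᶜ, ENNReal.ofReal (f x) ∂μ := by gcongr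
    _ = _ := by ring

/-! ### The section inequality tested against functions -/

lemma lintegral_mul_eq_lintegral_superlevel {Z : Type*} [MeasurableSpace Z] (m : Measure Z)
    {p q : Z → ℝ} (hp : Measurable p) (hq : Measurable q) (hq0 : ∀ z, 0 ≤ q z) :
    ∫⁻ z, ENNReal.ofReal (p z) * ENNReal.ofReal (q z) ∂m =
      ∫⁻ s in Set.Ioi 0, ∫⁻ z in {z | s < q z}, ENNReal.ofReal (p z) ∂m := by
  have h := lintegral_withDensity_eq_lintegral_mul₀ (μ := m) (f := fun z => ENNReal.ofReal (p z))
    (by fun_prop) (g := fun z => ENNReal.ofReal (q z)) (by fun_prop)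
  simp only [Pi.mul_apply] at h
  rw [← h, lintegral_eq_lintegral_meas_lt _ (ae_of_all _ hq0) hq.aemeasurable]
  refine lintegral_congr fun s => ?_
  rw [withDensity_apply _ (measurableSet_lt measurable_const hq)]

/-- Use the section inequality with `A = {u > s}` and `B = {w ≤ s}` and integrate over `s > 0`. By
Tonelli the product term measures the `s` with `w y ≤ s < u x`, a set of length at most `(u x - w
y)⁺`. -/
lemma SectionBound.lintegral_mul_le {μ : Measure X} {ν : Measure Y} [IsFiniteMeasure μ]
    [IsFiniteMeasure ν] {f : X → ℝ} {g : Y → ℝ} (h : SectionBound μ ν f g)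
    (hf : Measurable f) (hg : Measurable g) {u : X → ℝ} {w : Y → ℝ} (hu : Measurable u)
    (hw : Measurable w) (hu0 : ∀ x, 0 ≤ u x) (hw0 : ∀ y, 0 ≤ w y) :
    ∫⁻ x, ENNReal.ofReal (f x) * ENNReal.ofReal (u x) ∂μ ≤
      ∫⁻ y, ENNReal.ofReal (g y) * ENNReal.ofReal (w y) ∂ν +
        ∫⁻ z, ENNReal.ofReal (u z.1 - w z.2) ∂(μ.prod ν) := by
  have hu_anti : Antitone fun s : ℝ => μ {x | s < u x} :=
    fun _ _ hst => measure_mono fun _ hx => lt_of_le_of_lt hst hx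
  have hw_mono : Monotone fun s : ℝ => ν {y | w y ≤ s} :=
    fun _ _ hst => measure_mono fun _ hx => le_trans hx hst
  have hS : MeasurableSet {p : ℝ × (X × Y) | p.1 < u p.2.1 ∧ w p.2.2 ≤ p.1} :=
    (measurableSet_lt measurable_fst (by fun_prop)).inter
      (measurableSet_le (by fun_prop) measurable_fst)
  rw [lintegral_mul_eq_lintegral_superlevel μ hf hu hu0,
    lintegral_mul_eq_lintegral_superlevel ν hg hw hw0]
  calc ∫⁻ s in Set.Ioi (0 : ℝ), ∫⁻ x in {x | s < u x}, ENNReal.ofReal (f x) ∂μ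
      ≤ ∫⁻ s in Set.Ioi (0 : ℝ), (μ {x | s < u x} * ν {y | w y ≤ s} +
          ∫⁻ y in {y | s < w y}, ENNReal.ofReal (g y) ∂ν) := by
        refine lintegral_mono fun s => ?_
        refine (h _ {y | w y ≤ s} (measurableSet_lt measurable_const hu)
          (measurableSet_le hw measurable_const)).trans (le_of_eq ?_)
        congr 4
        ext y
        simp
    _ = (∫⁻ s in Set.Ioi (0 : ℝ), ∫⁻ z,
          {p : ℝ × (X × Y) | p.1 < u p.2.1 ∧ w p.2.2 ≤ p.1}.indicator 1 (s, z) ∂(μ.prod ν)) +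
          ∫⁻ s in Set.Ioi (0 : ℝ), ∫⁻ y in {y | s < w y}, ENNReal.ofReal (g y) ∂ν := by
        rw [lintegral_add_left (show Measurable fun s => μ {x | s < u x} * ν {y | w y ≤ s} from
          hu_anti.measurable.mul hw_mono.measurable)]
        congr 1
        refine lintegral_congr fun s => ?_
        have h2 : ∀ z, {p : ℝ × (X × Y) | p.1 < u p.2.1 ∧ w p.2.2 ≤ p.1}.indicator
            (1 : ℝ × (X × Y) → ℝ≥0∞) (s, z) =
              ({x | s < u x} ×ˢ {y | w y ≤ s}).indicator 1 z := fun z => rfl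
        simp_rw [h2]
        rw [lintegral_indicator_one ((measurableSet_lt measurable_const hu).prod
          (measurableSet_le hw measurable_const)), Measure.prod_prod]
    _ ≤ _ := by
        have hswap := lintegral_lintegral_swap (μ := volume.restrict (Set.Ioi (0 : ℝ)))
          (ν := μ.prod ν) (f := fun s z => {p : ℝ × (X × Y) |
            p.1 < u p.2.1 ∧ w p.2.2 ≤ p.1}.indicator (1 : ℝ × (X × Y) → ℝ≥0∞) (s, z))
          (measurable_one.indicator hS).aemeasurable
        rw [add_comm, hswap]
        gcongr with z
        have h2 : ∀ s, {p : ℝ × (X × Y) | p.1 < u p.2.1 ∧ w p.2.2 ≤ p.1}.indicator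
            (1 : ℝ × (X × Y) → ℝ≥0∞) (s, z) = (Set.Ico (w z.2) (u z.1)).indicator 1 s := by
          intro s
          simp only [Set.indicator, Set.mem_ofPred_eq, Set.mem_Ico, and_comm]
          rfl
        simp_rw [h2]
        refine (setLIntegral_le_lintegral _ _).trans ?_
        rw [lintegral_indicator_one measurableSet_Ico, Real.volume_Ico]

/-- This is the domination needed for Hahn–Banach. The previous inequality is applied to the
nonnegative functions `u + M` and `M - v`; the two terms in `M` cancel since `f` and `g` have equal
integrals. -/
lemma SectionBound.integral_mul_add_le {μ : Measure X} {ν : Measure Y} [IsFiniteMeasure μ]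
    [IsFiniteMeasure ν] {f : X → ℝ} {g : Y → ℝ} (h : SectionBound μ ν f g)
    (hf : Measurable f) (hg : Measurable g) (hf0 : ∀ x, 0 ≤ f x) (hg0 : ∀ y, 0 ≤ g y)
    (hfi : Integrable f μ) (hgi : Integrable g ν) (hfg : ∫ x, f x ∂μ = ∫ y, g y ∂ν)
    {u : X → ℝ} {v : Y → ℝ} (hu : Measurable u) (hv : Measurable v) {M : ℝ}
    (huM : ∀ x, |u x| ≤ M) (hvM : ∀ y, |v y| ≤ M) :
    ∫ x, f x * u x ∂μ + ∫ y, g y * v y ∂ν ≤ ∫ z, max (u z.1 + v z.2) 0 ∂(μ.prod ν) := by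
  have hu0 : ∀ x, 0 ≤ u x + M := fun x => by linarith [neg_le_of_abs_le (huM x)]
  have hw0 : ∀ y, 0 ≤ M - v y := fun y => by linarith [le_of_abs_le (hvM y)]
  have h1 := h.lintegral_mul_le hf hg (u := fun x => u x + M) (w := fun y => M - v y)
    (by fun_prop) (by fun_prop) hu0 hw0
  have ifu : Integrable (fun x => f x * u x) μ :=
    hfi.mul_bdd (c := M) hu.aestronglyMeasurable (ae_of_all _ huM)
  have igv : Integrable (fun y => g y * v y) ν :=
    hgi.mul_bdd (c := M) hv.aestronglyMeasurable (ae_of_all _ hvM)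
  have imax : Integrable (fun z : X × Y => max (u z.1 + v z.2) 0) (μ.prod ν) := by
    refine Integrable.of_bound (by fun_prop) (M + M) (ae_of_all _ fun z => ?_)
    rw [Real.norm_of_nonneg (le_max_right _ _)]
    have h2 := le_of_abs_le (huM z.1)
    have h3 := le_of_abs_le (hvM z.2)
    have h4 := hu0 z.1
    exact max_le (by linarith) (by linarith)
  have e1 : (fun x => ENNReal.ofReal (f x) * ENNReal.ofReal (u x + M)) =
      fun x => ENNReal.ofReal (f x * u x + f x * M) := by
    ext x; rw [← ENNReal.ofReal_mul (hf0 x), mul_add]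
  have e2 : (fun y => ENNReal.ofReal (g y) * ENNReal.ofReal (M - v y)) =
      fun y => ENNReal.ofReal (g y * M - g y * v y) := by
    ext y; rw [← ENNReal.ofReal_mul (hg0 y), mul_sub]
  have e3 : (fun z : X × Y => ENNReal.ofReal (u z.1 + M - (M - v z.2))) =
      fun z => ENNReal.ofReal (max (u z.1 + v z.2) 0) := by
    ext z
    rw [ENNReal.ofReal_max, ENNReal.ofReal_zero, max_eq_left zero_le]
    ring_nf
  have n2 : ∀ y, 0 ≤ g y * M - g y * v y := fun y => by
    rw [← mul_sub]; exact mul_nonneg (hg0 y) (hw0 y)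
  have n3 : ∀ z : X × Y, 0 ≤ max (u z.1 + v z.2) 0 := fun z => le_max_right _ _
  have ig2 : Integrable (fun y => g y * M - g y * v y) ν := (hgi.mul_const M).sub igv
  have ig1 : Integrable (fun x => f x * u x + f x * M) μ := ifu.add (hfi.mul_const M)
  rw [e1, e2, e3, ← ofReal_integral_eq_lintegral_ofReal ig1 (ae_of_all _ fun x => by
        simpa [mul_add] using mul_nonneg (hf0 x) (hu0 x)),
    ← ofReal_integral_eq_lintegral_ofReal ig2 (ae_of_all _ n2),
    ← ofReal_integral_eq_lintegral_ofReal imax (ae_of_all _ n3),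
    ← ENNReal.ofReal_add (integral_nonneg n2) (integral_nonneg n3),
    ENNReal.ofReal_le_ofReal_iff (add_nonneg (integral_nonneg n2) (integral_nonneg n3)),
    integral_add ifu (hfi.mul_const M), integral_sub (hgi.mul_const M) igv, integral_mul_const,
    integral_mul_const, hfg] at h1
  linarith

/-! ### Dominated functionals on `L²`: existence and compactness -/

/-- The element of `L²` represented by a simple function. -/
noncomputable def simpleToLp {Z : Type*} [MeasurableSpace Z] (m : Measure Z) [IsFiniteMeasure m] :
    SimpleFunc Z ℝ →ₗ[ℝ] Lp ℝ 2 m where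
  toFun φ := (φ.memLp_of_isFiniteMeasure 2 m).toLp φ
  map_add' _ _ := rfl
  map_smul' _ _ := rfl

lemma coeFn_simpleToLp {Z : Type*} [MeasurableSpace Z] (m : Measure Z) [IsFiniteMeasure m]
    (φ : SimpleFunc Z ℝ) : simpleToLp m φ =ᵐ[m] φ :=
  MemLp.coeFn_toLp (φ.memLp_of_isFiniteMeasure 2 m)

/-- The simple function `(x, y) ↦ u x + v y`. -/
noncomputable def simpleSum : (SimpleFunc X ℝ × SimpleFunc Y ℝ) →ₗ[ℝ] SimpleFunc (X × Y) ℝ where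
  toFun p := p.1.comp Prod.fst measurable_fst + p.2.comp Prod.snd measurable_snd
  map_add' p q := by ext z; simp; ring
  map_smul' c p := by ext z; simp

lemma integrable_mul_simpleFunc {Z : Type*} [MeasurableSpace Z] {m : Measure Z}
    {f : Z → ℝ} (hf : Integrable f m) (φ : SimpleFunc Z ℝ) :
    Integrable (fun z => f z * φ z) m := by
  obtain ⟨C, hC⟩ := φ.exists_forall_norm_le
  exact hf.mul_bdd (c := C) φ.measurable.aestronglyMeasurable (ae_of_all _ hC)

/-- Pairing of simple functions with an integrable function. -/
noncomputable def simplePairing {Z : Type*} [MeasurableSpace Z] {m : Measure Z} {f : Z → ℝ}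
    (hf : Integrable f m) : SimpleFunc Z ℝ →ₗ[ℝ] ℝ where
  toFun φ := ∫ z, f z * φ z ∂m
  map_add' φ ψ := by
    rw [← integral_add (integrable_mul_simpleFunc hf φ) (integrable_mul_simpleFunc hf ψ)]
    simp [mul_add]
  map_smul' c φ := by
    simp only [RingHom.id_apply, smul_eq_mul, ← integral_const_mul]
    refine integral_congr_ae (ae_of_all _ fun z => ?_)
    simp; ring

/-- The sublinear functional `φ ↦ ∫ φ⁺` on `L²`. -/
noncomputable def posIntegral {Z : Type*} [MeasurableSpace Z] (m : Measure Z)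
    (φ : Lp ℝ 2 m) : ℝ := ∫ z, max (φ z) 0 ∂m

section posIntegral
variable {Z : Type*} [MeasurableSpace Z] {m : Measure Z}

lemma posIntegral_congr {φ : Lp ℝ 2 m} {ψ : Z → ℝ} (h : φ =ᵐ[m] ψ) :
    posIntegral m φ = ∫ z, max (ψ z) 0 ∂m :=
  integral_congr_ae (h.mono fun z hz => by simp only [hz])

lemma posIntegral_smul {c : ℝ} (hc : 0 < c) (φ : Lp ℝ 2 m) :
    posIntegral m (c • φ) = c * posIntegral m φ := by
  rw [posIntegral_congr (Lp.coeFn_smul c φ), posIntegral, ← integral_const_mul]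
  refine integral_congr_ae (ae_of_all _ fun z => ?_)
  simp [mul_max_of_nonneg _ _ hc.le]

variable [IsFiniteMeasure m]

lemma integrable_of_Lp_two (φ : Lp ℝ 2 m) : Integrable φ m :=
  (Lp.memLp φ).integrable (by norm_num)

lemma integrable_posPart_Lp (φ : Lp ℝ 2 m) : Integrable (fun z => max (φ z) 0) m :=
  (integrable_of_Lp_two φ).pos_part

lemma posIntegral_add_le (φ ψ : Lp ℝ 2 m) :
    posIntegral m (φ + ψ) ≤ posIntegral m φ + posIntegral m ψ := by
  rw [posIntegral_congr (Lp.coeFn_add φ ψ), posIntegral, posIntegral,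
    ← integral_add (integrable_posPart_Lp φ) (integrable_posPart_Lp ψ)]
  refine integral_mono_ae ?_ ((integrable_posPart_Lp φ).add (integrable_posPart_Lp ψ))
    (ae_of_all _ fun z => ?_)
  · exact ((integrable_of_Lp_two φ).add (integrable_of_Lp_two ψ)).pos_part
  · simp only [Pi.add_apply]
    exact max_le (add_le_add (le_max_left _ _) (le_max_left _ _))
      (add_nonneg (le_max_right _ _) (le_max_right _ _))

end posIntegral

/-- Linear functionals on `L²(μ × ν)` which are dominated by `φ ↦ ∫ φ⁺` and have the
marginals `f` and `g` (seen as a set of plain functions, to use the product topology). -/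
def couplingFunctionals (μ : Measure X) (ν : Measure Y) [IsFiniteMeasure μ] [IsFiniteMeasure ν]
    (f : X → ℝ) (g : Y → ℝ) : Set (Lp ℝ 2 (μ.prod ν) → ℝ) :=
  {L | (∀ φ ψ, L (φ + ψ) = L φ + L ψ) ∧ (∀ (c : ℝ) φ, L (c • φ) = c * L φ) ∧
    (∀ φ, L φ ≤ posIntegral (μ.prod ν) φ) ∧
    ∀ p : SimpleFunc X ℝ × SimpleFunc Y ℝ, L (simpleToLp (μ.prod ν) (simpleSum p)) =
      ∫ x, f x * p.1 x ∂μ + ∫ y, g y * p.2 y ∂ν}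

lemma couplingFunctionals_nonempty {μ : Measure X} {ν : Measure Y} [IsFiniteMeasure μ]
    [IsFiniteMeasure ν] {f : X → ℝ} {g : Y → ℝ} (h : SectionBound μ ν f g)
    (hf : Measurable f) (hg : Measurable g) (hf0 : ∀ x, 0 ≤ f x) (hg0 : ∀ y, 0 ≤ g y)
    (hfi : Integrable f μ) (hgi : Integrable g ν) (hfg : ∫ x, f x ∂μ = ∫ y, g y ∂ν) :
    (couplingFunctionals μ ν f g).Nonempty := by
  let T : (SimpleFunc X ℝ × SimpleFunc Y ℝ) →ₗ[ℝ] Lp ℝ 2 (μ.prod ν) :=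
    simpleToLp (μ.prod ν) ∘ₗ simpleSum
  let l : (SimpleFunc X ℝ × SimpleFunc Y ℝ) →ₗ[ℝ] ℝ :=
    (simplePairing hfi).coprod (simplePairing hgi)
  have hl : ∀ p, l p ≤ posIntegral (μ.prod ν) (T p) := by
    intro p
    obtain ⟨C, hC⟩ := p.1.exists_forall_norm_le
    obtain ⟨D, hD⟩ := p.2.exists_forall_norm_le
    have := h.integral_mul_add_le hf hg hf0 hg0 hfi hgi hfg p.1.measurable p.2.measurable
      (M := max C D) (fun x => (hC x).trans (le_max_left _ _))
      (fun x => (hD x).trans (le_max_right _ _))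
    refine this.trans (le_of_eq ?_)
    exact (posIntegral_congr (coeFn_simpleToLp (μ.prod ν) (simpleSum p))).symm
  -- Domination at both `p` and `-p` makes `l` vanish wherever `T` does, so `l` descends to the
  -- range of `T`, where Hahn–Banach starts.
  have hker : LinearMap.ker T ≤ LinearMap.ker l := by
    intro p hp
    have hp : T p = 0 := hp
    have h0 : posIntegral (μ.prod ν) (0 : Lp ℝ 2 (μ.prod ν)) = 0 := by
      rw [posIntegral_congr (Lp.coeFn_zero ℝ 2 (μ.prod ν))]; simp
    have h1 := hl p
    have h2 := hl (-p)
    rw [map_neg, map_neg, hp, neg_zero, h0] at h2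
    rw [hp, h0] at h1
    exact le_antisymm h1 (by linarith)
  obtain ⟨L, hL, hLN⟩ := exists_extension_of_le_sublinear
    ⟨LinearMap.range T, (LinearMap.ker T).liftQ l hker ∘ₗ T.quotKerEquivRange.symm.toLinearMap⟩
    (posIntegral (μ.prod ν)) (fun c hc φ => posIntegral_smul hc φ) posIntegral_add_le
    (by
      rintro ⟨_, p, rfl⟩
      refine le_trans (le_of_eq ?_) (hl p)
      have : T.quotKerEquivRange.symm ⟨T p, p, rfl⟩ = (LinearMap.ker T).mkQ p := by
        rw [LinearEquiv.symm_apply_eq]; rfl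
      change (LinearMap.ker T).liftQ l hker (T.quotKerEquivRange.symm ⟨T p, p, rfl⟩) = _
      rw [this]; rfl)
  refine ⟨L, L.map_add, fun c φ => by simp, hLN, fun p => ?_⟩
  have h1 := hL ⟨T p, p, rfl⟩
  have : T.quotKerEquivRange.symm ⟨T p, p, rfl⟩ = (LinearMap.ker T).mkQ p := by
    rw [LinearEquiv.symm_apply_eq]; rfl
  change L (T p) = (LinearMap.ker T).liftQ l hker (T.quotKerEquivRange.symm ⟨T p, p, rfl⟩) at h1
  rw [this] at h1
  exact h1

/-- Tychonoff: domination at `φ` and `-φ` traps each value in a compact interval, and every defining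
condition is closed for pointwise convergence. -/
lemma isCompact_couplingFunctionals (μ : Measure X) (ν : Measure Y) [IsFiniteMeasure μ]
    [IsFiniteMeasure ν] (f : X → ℝ) (g : Y → ℝ) :
    IsCompact (couplingFunctionals μ ν f g) := by
  refine (isCompact_univ_pi fun φ : Lp ℝ 2 (μ.prod ν) =>
    isCompact_Icc (a := -posIntegral (μ.prod ν) (-φ))
      (b := posIntegral (μ.prod ν) φ)).of_isClosed_subset ?_ ?_
  · simp only [couplingFunctionals, Set.ofPred_and, Set.ofPred_forall]
    refine ((isClosed_iInter fun φ => isClosed_iInter fun ψ => isClosed_eq ?_ ?_).inter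
      ((isClosed_iInter fun c => isClosed_iInter fun φ => isClosed_eq ?_ ?_).inter
      ((isClosed_iInter fun φ => isClosed_le ?_ ?_).inter
      (isClosed_iInter fun p => isClosed_eq ?_ ?_)))) <;> fun_prop
  · rintro L ⟨-, hs, hN, -⟩ φ -
    refine ⟨?_, hN φ⟩
    have := hN (-φ)
    rw [← neg_one_smul ℝ φ, hs] at this
    rw [← neg_one_smul ℝ φ]
    linarith

lemma exists_extreme_couplingFunctional {μ : Measure X} {ν : Measure Y} [IsFiniteMeasure μ]
    [IsFiniteMeasure ν] {f : X → ℝ} {g : Y → ℝ}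
    (h : (couplingFunctionals μ ν f g).Nonempty) :
    ((couplingFunctionals μ ν f g).extremePoints ℝ).Nonempty :=
  (isCompact_couplingFunctionals μ ν f g).extremePoints_nonempty h

/-! ### Couplings and extremality -/

/-- `k` is a measurable function with values in `[0, 1]` whose marginals are `f` and `g`. -/
structure IsCoupling (μ : Measure X) (ν : Measure Y) (f : X → ℝ) (g : Y → ℝ)
    (k : X × Y → ℝ) : Prop where
  measurable : Measurable k
  nonneg : ∀ z, 0 ≤ k z
  le_one : ∀ z, k z ≤ 1
  fst : ∀ᵐ x ∂μ, ∫ y, k (x, y) ∂ν = f x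
  snd : ∀ᵐ y ∂ν, ∫ x, k (x, y) ∂μ = g y

/-- Cauchy–Schwarz against the constant `1`. It makes dominated functionals continuous, hence
representable by Riesz. -/
lemma posIntegral_le_norm {Z : Type*} [MeasurableSpace Z] (m : Measure Z) [IsFiniteMeasure m]
    (φ : Lp ℝ 2 m) :
    posIntegral m φ ≤ ‖indicatorConstLp (μ := m) 2 .univ (measure_ne_top m _) (1 : ℝ)‖ * ‖φ‖ := by
  have h1 := L2.inner_indicatorConstLp_one (𝕜 := ℝ) (μ := m) .univ (measure_ne_top m _) |φ|
  have h2 := (le_abs_self _).trans (abs_real_inner_le_norm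
    (indicatorConstLp (μ := m) 2 .univ (measure_ne_top m _) (1 : ℝ)) |φ|)
  rw [norm_abs_eq_norm, h1, Measure.restrict_univ] at h2
  refine le_trans ?_ h2
  refine integral_mono_ae (integrable_posPart_Lp φ) (integrable_of_Lp_two _) ?_
  filter_upwards [Lp.coeFn_abs φ] with z hz
  rw [hz]
  exact max_le (le_abs_self _) (abs_nonneg _)

lemma setIntegral_eq_integral_mul_simpleFunc {Z : Type*} [MeasurableSpace Z] {m : Measure Z}
    {p : Z → ℝ} {A : Set Z} (hA : MeasurableSet A) : ∫ z in A, p z ∂m =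
      ∫ z, p z * SimpleFunc.piecewise A hA (.const Z 1) (.const Z 0) z ∂m := by
  rw [← integral_indicator hA]
  refine integral_congr_ae (ae_of_all _ fun z => ?_)
  by_cases hz : z ∈ A <;> simp [hz]

section
variable {μ : Measure X} {ν : Measure Y} [IsFiniteMeasure μ] [IsFiniteMeasure ν]
  {f : X → ℝ} {g : Y → ℝ}

lemma integrable_bounded_mul {Z : Type*} [MeasurableSpace Z] {m : Measure Z} {k φ : Z → ℝ}
    (hk : Measurable k) (h0 : ∀ z, 0 ≤ k z) (h1 : ∀ z, k z ≤ 1) (hφ : Integrable φ m) :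
    Integrable (fun z => k z * φ z) m :=
  hφ.bdd_mul (c := 1) hk.aestronglyMeasurable
    (ae_of_all _ fun z => by rw [Real.norm_of_nonneg (h0 z)]; exact h1 z)

/-- Converse of the representation below: perturbed couplings yield competitors inside the convex
set, to which extremality applies. -/
lemma IsCoupling.pairing_mem {k : X × Y → ℝ} (hk : IsCoupling μ ν f g k) :
    (fun φ => ∫ z, k z * φ z ∂(μ.prod ν)) ∈ couplingFunctionals μ ν f g := by
  have hint := fun φ : Lp ℝ 2 (μ.prod ν) =>
    integrable_bounded_mul hk.measurable hk.nonneg hk.le_one (integrable_of_Lp_two φ)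
  refine ⟨fun φ ψ => ?_, fun c φ => ?_, fun φ => ?_, fun p => ?_⟩
  · rw [← integral_add (hint φ) (hint ψ)]
    refine integral_congr_ae ?_
    filter_upwards [Lp.coeFn_add φ ψ] with z hz
    rw [hz, Pi.add_apply, mul_add]
  · rw [← integral_const_mul]
    refine integral_congr_ae ?_
    filter_upwards [Lp.coeFn_smul c φ] with z hz
    rw [hz, Pi.smul_apply, smul_eq_mul]
    ring
  · refine integral_mono (hint φ) (integrable_posPart_Lp φ) fun z => ?_
    exact (mul_le_mul_of_nonneg_left (le_max_left _ 0) (hk.nonneg z)).trans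
      (mul_le_of_le_one_left (le_max_right _ _) (hk.le_one z))
  · have i1 : Integrable (fun z : X × Y => k z * p.1 z.1) (μ.prod ν) :=
      integrable_bounded_mul hk.measurable hk.nonneg hk.le_one
        ((p.1.comp Prod.fst measurable_fst).integrable_of_isFiniteMeasure)
    have i2 : Integrable (fun z : X × Y => k z * p.2 z.2) (μ.prod ν) :=
      integrable_bounded_mul hk.measurable hk.nonneg hk.le_one
        ((p.2.comp Prod.snd measurable_snd).integrable_of_isFiniteMeasure)
    calc ∫ z, k z * simpleToLp (μ.prod ν) (simpleSum p) z ∂(μ.prod ν)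
        = ∫ z, (k z * p.1 z.1 + k z * p.2 z.2) ∂(μ.prod ν) := by
          refine integral_congr_ae ?_
          filter_upwards [coeFn_simpleToLp (μ.prod ν) (simpleSum p)] with z hz
          rw [hz, ← mul_add]; rfl
      _ = (∫ x, f x * p.1 x ∂μ) + ∫ y, g y * p.2 y ∂ν := by
          rw [integral_add i1 i2, integral_prod _ i1, integral_prod_symm _ i2]
          simp only [integral_mul_const]
          congr 1
          · exact integral_congr_ae (hk.fst.mono fun x hx => by simp only [hx])
          · exact integral_congr_ae (hk.snd.mono fun x hx => by simp only [hx])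

/-- The Riesz representative lies between `0` and `1` almost everywhere, as domination on indicators
and their negatives shows. Testing on indicators of sets in one factor identifies the marginals. -/
lemma exists_coupling_of_mem {L : Lp ℝ 2 (μ.prod ν) → ℝ} (hL : L ∈ couplingFunctionals μ ν f g)
    (hfi : Integrable f μ) (hgi : Integrable g ν) :
    ∃ k, IsCoupling μ ν f g k ∧ ∀ φ, L φ = ∫ z, k z * φ z ∂(μ.prod ν) := by
  obtain ⟨hadd, hsmul, hN, hmarg⟩ := hL
  set C := ‖indicatorConstLp (μ := μ.prod ν) 2 .univ (measure_ne_top _ _) (1 : ℝ)‖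
  have hneg : ∀ φ, L (-φ) = -L φ := fun φ => by rw [← neg_one_smul ℝ φ, hsmul]; ring
  let ℓ : StrongDual ℝ (Lp ℝ 2 (μ.prod ν)) :=
    LinearMap.mkContinuous { toFun := L, map_add' := hadd, map_smul' := fun c φ => hsmul c φ } C
    (fun φ => by
      change |L φ| ≤ _
      refine abs_le.2 ⟨?_, (hN φ).trans (posIntegral_le_norm _ φ)⟩
      have := (hN (-φ)).trans (posIntegral_le_norm _ (-φ))
      rw [hneg, norm_neg] at this
      linarith)
  obtain ⟨κ, hκ⟩ : ∃ κ : Lp ℝ 2 (μ.prod ν), ∀ φ, inner ℝ κ φ = L φ :=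
    ⟨(InnerProductSpace.toDual ℝ _).symm ℓ, fun φ => InnerProductSpace.toDual_symm_apply⟩
  have hset : ∀ (s : Set (X × Y)) (hs : MeasurableSet s),
      L (indicatorConstLp 2 hs (measure_ne_top _ _) 1) = ∫ z in s, κ z ∂(μ.prod ν) :=
    fun s hs => by rw [← hκ, real_inner_comm, L2.inner_indicatorConstLp_one]
  have hle : κ ≤ᵐ[μ.prod ν] fun _ => (1 : ℝ) := by
    refine ae_le_of_forall_setIntegral_le (integrable_of_Lp_two κ) (integrable_const _)
      fun s hs _ => ?_
    rw [← hset s hs]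
    refine (hN _).trans (le_of_eq ?_)
    rw [posIntegral_congr indicatorConstLp_coeFn, ← integral_indicator hs]
    refine integral_congr_ae (ae_of_all _ fun z => ?_)
    by_cases hz : z ∈ s <;> simp [hz]
  have hge : (fun _ => (0 : ℝ)) ≤ᵐ[μ.prod ν] κ := by
    refine ae_le_of_forall_setIntegral_le (integrable_const _) (integrable_of_Lp_two κ)
      fun s hs _ => ?_
    rw [← hset s hs]
    have h1 := hN (-indicatorConstLp 2 hs (measure_ne_top _ _) 1)
    have h2 : posIntegral (μ.prod ν) (-indicatorConstLp 2 hs (measure_ne_top _ _) 1) = 0 := by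
      have : -indicatorConstLp (μ := μ.prod ν) 2 hs (measure_ne_top _ _) (1 : ℝ)
          =ᵐ[μ.prod ν] fun z => -(s.indicator (fun _ => 1) z) := by
        filter_upwards [Lp.coeFn_neg (indicatorConstLp (μ := μ.prod ν) 2 hs
          (measure_ne_top _ _) (1 : ℝ)), indicatorConstLp_coeFn (μ := μ.prod ν) (p := 2) (hs := hs)
          (hμs := measure_ne_top _ _) (c := (1 : ℝ))] with z h1 h2
        rw [h1, Pi.neg_apply, h2]
      rw [posIntegral_congr this]
      refine integral_eq_zero_of_ae (ae_of_all _ fun z => ?_)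
      by_cases hz : z ∈ s <;> simp [hz]
    rw [hneg, h2] at h1
    simpa using h1
  have hκm : Measurable κ := (Lp.stronglyMeasurable κ).measurable
  -- Truncation makes the bounds hold at every point without changing the class.
  let k : X × Y → ℝ := fun z => max 0 (min 1 (κ z))
  have hkm : Measurable k := by fun_prop
  have hk0 : ∀ z, 0 ≤ k z := fun z => le_max_left _ _
  have hk1 : ∀ z, k z ≤ 1 := fun z => max_le zero_le_one (min_le_left _ _)
  have hkκ : k =ᵐ[μ.prod ν] κ := by
    filter_upwards [hle, hge] with z h1 h2
    simp only [k]
    rw [min_eq_right h1, max_eq_right h2]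
  have hrep : ∀ φ, L φ = ∫ z, k z * φ z ∂(μ.prod ν) := by
    intro φ
    rw [← hκ, L2.inner_def]
    refine integral_congr_ae ?_
    filter_upwards [hkκ] with z hz
    rw [hz]
    simp [mul_comm]
  have hki : Integrable k (μ.prod ν) := (integrable_of_Lp_two κ).congr hkκ.symm
  have hpair : ∀ p : SimpleFunc X ℝ × SimpleFunc Y ℝ,
      ∫ z, k z * (p.1 z.1 + p.2 z.2) ∂(μ.prod ν) =
        ∫ x, f x * p.1 x ∂μ + ∫ y, g y * p.2 y ∂ν := by
    intro p
    rw [← hmarg p, hrep]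
    refine integral_congr_ae ?_
    filter_upwards [coeFn_simpleToLp (μ.prod ν) (simpleSum p)] with z hz
    rw [hz]; rfl
  refine ⟨k, ⟨hkm, hk0, hk1, ?_, ?_⟩, hrep⟩
  · refine Integrable.ae_eq_of_forall_setIntegral_eq _ _ hki.integral_prod_left hfi
      fun A hA _ => ?_
    have h1 := hpair (SimpleFunc.piecewise A hA (.const X 1) (.const X 0), 0)
    simp only [SimpleFunc.coe_zero, Pi.zero_apply, add_zero, mul_zero, integral_zero] at h1
    have hi : Integrable (fun z : X × Y => k z *
        SimpleFunc.piecewise A hA (.const X 1) (.const X 0) z.1) (μ.prod ν) :=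
      integrable_bounded_mul hkm hk0 hk1
        (((SimpleFunc.piecewise A hA (.const X 1) (.const X 0)).comp Prod.fst
          measurable_fst).integrable_of_isFiniteMeasure)
    rw [integral_prod _ hi] at h1
    rw [setIntegral_eq_integral_mul_simpleFunc hA, setIntegral_eq_integral_mul_simpleFunc hA, ← h1]
    simp only [integral_mul_const]
  · refine Integrable.ae_eq_of_forall_setIntegral_eq _ _ hki.integral_prod_right hgi
      fun B hB _ => ?_
    have h1 := hpair (0, SimpleFunc.piecewise B hB (.const Y 1) (.const Y 0))
    simp only [SimpleFunc.coe_zero, Pi.zero_apply, zero_add, mul_zero,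
      integral_zero] at h1
    have hi : Integrable (fun z : X × Y => k z *
        SimpleFunc.piecewise B hB (.const Y 1) (.const Y 0) z.2) (μ.prod ν) :=
      integrable_bounded_mul hkm hk0 hk1
        (((SimpleFunc.piecewise B hB (.const Y 1) (.const Y 0)).comp Prod.snd
          measurable_snd).integrable_of_isFiniteMeasure)
    rw [integral_prod_symm _ hi] at h1
    rw [setIntegral_eq_integral_mul_simpleFunc hB, setIntegral_eq_integral_mul_simpleFunc hB, ← h1]
    simp only [integral_mul_const]

/-- A coupling which admits no nontrivial perturbation with vanishing marginals that is dominated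
by a multiple of `min k (1 - k)`. -/
structure IsExtremalCoupling (μ : Measure X) (ν : Measure Y) (f : X → ℝ) (g : Y → ℝ)
    (k : X × Y → ℝ) : Prop extends IsCoupling μ ν f g k where
  extremal : ∀ (h : X × Y → ℝ) (C : ℝ), Measurable h → (∀ z, |h z| ≤ C * min (k z) (1 - k z)) →
    (∀ x, ∫ y, h (x, y) ∂ν = 0) → (∀ y, ∫ x, h (x, y) ∂μ = 0) → h =ᵐ[μ.prod ν] 0

lemma integrable_of_mem_unit {Z : Type*} [MeasurableSpace Z] {m : Measure Z} [IsFiniteMeasure m]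
    {k : Z → ℝ} (hk : Measurable k) (h1 : ∀ z, |k z| ≤ 1) : Integrable k m :=
  Integrable.of_bound hk.aestronglyMeasurable 1 (ae_of_all _ h1)

lemma integrable_fst_section {k : X × Y → ℝ} (hk : Measurable k) (h1 : ∀ z, |k z| ≤ 1) (x : X) :
    Integrable (fun y => k (x, y)) ν :=
  integrable_of_mem_unit (hk.comp measurable_prodMk_left) fun _ => h1 _

lemma integrable_snd_section {k : X × Y → ℝ} (hk : Measurable k) (h1 : ∀ z, |k z| ≤ 1) (y : Y) :
    Integrable (fun x => k (x, y)) μ :=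
  integrable_of_mem_unit (hk.comp measurable_prodMk_right) fun _ => h1 _

lemma IsCoupling.add {k h : X × Y → ℝ} (hk : IsCoupling μ ν f g k) (hh : Measurable h)
    (hle : ∀ z, |h z| ≤ min (k z) (1 - k z)) (hx : ∀ x, ∫ y, h (x, y) ∂ν = 0)
    (hy : ∀ y, ∫ x, h (x, y) ∂μ = 0) : IsCoupling μ ν f g (fun z => k z + h z) := by
  have hk1 : ∀ z, |k z| ≤ 1 := fun z => by rw [abs_of_nonneg (hk.nonneg z)]; exact hk.le_one z
  have hh1 : ∀ z, |h z| ≤ 1 := fun z =>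
    (hle z).trans ((min_le_left _ _).trans (hk.le_one z))
  refine ⟨hk.measurable.add hh, fun z => ?_, fun z => ?_, ?_, ?_⟩
  · have := neg_le_of_abs_le ((hle z).trans (min_le_left _ _)); linarith
  · have := le_of_abs_le ((hle z).trans (min_le_right _ _)); linarith
  · filter_upwards [hk.fst] with x hx'
    rw [integral_add (integrable_fst_section hk.measurable hk1 x) (integrable_fst_section hh hh1 x),
      hx, hx', add_zero]
  · filter_upwards [hk.snd] with y hy'
    rw [integral_add (integrable_snd_section hk.measurable hk1 y) (integrable_snd_section hh hh1 y),
      hy, hy', add_zero]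

/-- After rescaling, `k + h` and `k - h` are both couplings with midpoint `k`, so extremality of the
functional makes `h` pair to zero with all of `L²`. -/
lemma exists_extremalCoupling (h : SectionBound μ ν f g)
    (hf : Measurable f) (hg : Measurable g) (hf0 : ∀ x, 0 ≤ f x) (hg0 : ∀ y, 0 ≤ g y)
    (hfi : Integrable f μ) (hgi : Integrable g ν) (hfg : ∫ x, f x ∂μ = ∫ y, g y ∂ν) :
    ∃ k, IsExtremalCoupling μ ν f g k := by
  obtain ⟨L, hL⟩ := exists_extreme_couplingFunctional
    (couplingFunctionals_nonempty h hf hg hf0 hg0 hfi hgi hfg)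
  rw [mem_extremePoints] at hL
  obtain ⟨k, hk, hLk⟩ := exists_coupling_of_mem hL.1 hfi hgi
  refine ⟨k, hk, fun h₀ C hh₀ hC hx₀ hy₀ => ?_⟩
  have hm0 : ∀ z, 0 ≤ min (k z) (1 - k z) := fun z =>
    le_min (hk.nonneg z) (by linarith [hk.le_one z])
  -- The maximum with `1` keeps the scaling factor positive whatever the sign of `C`.
  set D := max C 1 with hD_def
  have hD : 0 < D := lt_of_lt_of_le one_pos (le_max_right _ _)
  let h : X × Y → ℝ := fun z => D⁻¹ * h₀ z
  have hh : Measurable h := hh₀.const_mul _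
  have hle : ∀ z, |h z| ≤ min (k z) (1 - k z) := fun z => by
    simp only [h, abs_mul, abs_of_pos (inv_pos.2 hD)]
    rw [inv_mul_le_iff₀ hD]
    exact (hC z).trans (mul_le_mul_of_nonneg_right (le_max_left _ _) (hm0 z))
  have hx : ∀ x, ∫ y, h (x, y) ∂ν = 0 := fun x => by
    simp only [h, integral_const_mul, hx₀, mul_zero]
  have hy : ∀ y, ∫ x, h (x, y) ∂μ = 0 := fun y => by
    simp only [h, integral_const_mul, hy₀, mul_zero]
  have hp := (hk.add hh hle hx hy).pairing_mem
  have hn := (hk.add (h := fun z => -h z) hh.neg (fun z => by rw [abs_neg]; exact hle z)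
    (fun x => by rw [integral_neg, hx, neg_zero])
    (fun y => by rw [integral_neg, hy, neg_zero])).pairing_mem
  have hh1 : ∀ z, |h z| ≤ 1 := fun z => (hle z).trans ((min_le_left _ _).trans (hk.le_one z))
  have ik := fun φ : Lp ℝ 2 (μ.prod ν) =>
    integrable_bounded_mul hk.measurable hk.nonneg hk.le_one (integrable_of_Lp_two φ)
  have ih : ∀ φ : Lp ℝ 2 (μ.prod ν), Integrable (fun z => h z * φ z) (μ.prod ν) := fun φ =>
    (integrable_of_Lp_two φ).bdd_mul (c := 1) hh.aestronglyMeasurable (ae_of_all _ hh1)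
  have ihn : ∀ φ : Lp ℝ 2 (μ.prod ν), Integrable (fun z => -(h z * φ z)) (μ.prod ν) :=
    fun φ => (ih φ).neg
  have hseg := (hL.2 _ hp _ hn ⟨1 / 2, 1 / 2, by norm_num, by norm_num, by norm_num, by
    ext φ
    simp only [Pi.add_apply, Pi.smul_apply, smul_eq_mul, add_mul, neg_mul]
    rw [integral_add (ik φ) (ih φ), integral_add (ik φ) (ihn φ), integral_neg, hLk]
    ring⟩).1
  have hmem : MemLp h 2 (μ.prod ν) :=
    MemLp.of_bound hh.aestronglyMeasurable 1 (ae_of_all _ hh1)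
  -- Pairing `h` with itself gives `∫ h² = 0`.
  have h0 := congrFun hseg (hmem.toLp h)
  simp only [add_mul] at h0
  rw [integral_add (ik _) (ih _), hLk, add_eq_left] at h0
  have h1 : ∫ z, h z * h z ∂(μ.prod ν) = 0 := by
    rw [← h0]
    refine integral_congr_ae ?_
    filter_upwards [hmem.coeFn_toLp] with z hz
    rw [hz]
  rw [integral_eq_zero_iff_of_nonneg (fun z => mul_self_nonneg _)
    (integrable_of_mem_unit (hh.mul hh) fun z => by
      rw [abs_mul]
      exact mul_le_one₀ (hh1 z) (abs_nonneg _) (hh1 z))] at h1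
  filter_upwards [h1] with z hz
  have : h z = 0 := mul_self_eq_zero.1 hz
  simpa [h, hD.ne'] using this

end

/-! ### Perturbations on the corners of rectangles -/

lemma integral_integral_eq_zero_of_antisymm {Z : Type*} [MeasurableSpace Z] {m : Measure Z}
    [IsFiniteMeasure m] {J : Z × Z → ℝ} (hJ : Measurable J) (h1 : ∀ z, |J z| ≤ 1)
    (hanti : ∀ x y, J (y, x) = -J (x, y)) : ∫ x, ∫ y, J (x, y) ∂m ∂m = 0 := by
  have h := integral_integral_swap (f := fun x y => J (x, y)) (μ := m) (ν := m)
    (integrable_of_mem_unit hJ h1)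
  have h2 : ∫ y, ∫ x, J (x, y) ∂m ∂m = -∫ y, ∫ x, J (y, x) ∂m ∂m := by
    rw [← integral_neg]
    refine integral_congr_ae (ae_of_all _ fun y => ?_)
    simp only [← integral_neg]
    exact integral_congr_ae (ae_of_all _ fun x => hanti y x)
  linarith

/-- The kernel of the perturbation supported on the four corners of rectangles. -/
def cornerKernel (θ : X × Y → ℝ) (a : X × X → ℝ) (b : Y × Y → ℝ) (z z' : X × Y) : ℝ :=
  θ z * (θ (z.1, z'.2) * θ (z'.1, z.2) * θ z') * (a (z.1, z'.1) * b (z.2, z'.2))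

section cornerKernel

variable {μ : Measure X} {ν : Measure Y} [IsFiniteMeasure μ] [IsFiniteMeasure ν]
  {θ : X × Y → ℝ} {a : X × X → ℝ} {b : Y × Y → ℝ}

omit [MeasurableSpace X] [MeasurableSpace Y] in
lemma abs_cornerKernel_le (h0 : ∀ z, 0 ≤ θ z) (h1 : ∀ z, θ z ≤ 1)
    (ha : ∀ p, |a p| ≤ 1) (hb : ∀ p, |b p| ≤ 1) (z z' : X × Y) :
    |cornerKernel θ a b z z'| ≤ θ z := by
  have e1 : θ (z.1, z'.2) * θ (z'.1, z.2) * θ z' ≤ 1 :=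
    mul_le_one₀ (mul_le_one₀ (h1 _) (h0 _) (h1 _)) (h0 _) (h1 _)
  have e0 : 0 ≤ θ (z.1, z'.2) * θ (z'.1, z.2) * θ z' :=
    mul_nonneg (mul_nonneg (h0 _) (h0 _)) (h0 _)
  rw [cornerKernel, abs_mul, abs_mul (a _), abs_of_nonneg (mul_nonneg (h0 z) e0)]
  calc _ ≤ θ z * 1 * 1 :=
        mul_le_mul (mul_le_mul_of_nonneg_left e1 (h0 z))
          (mul_le_one₀ (ha _) (abs_nonneg _) (hb _)) (by positivity) (by simpa using h0 z)
    _ = θ z := by ring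

lemma measurable_cornerKernel (hθ : Measurable θ) (ha : Measurable a) (hb : Measurable b) :
    Measurable fun p : (X × Y) × (X × Y) => cornerKernel θ a b p.1 p.2 := by
  unfold cornerKernel
  fun_prop

/-- For fixed `x` and `x'`, exchanging `y` and `y'` permutes the four corners, so the product of the
`θ` values is unchanged while `b` changes sign. Fubini brings `x'` outside to use this. -/
lemma integral_cornerKernel_fst (hθ : Measurable θ) (h0 : ∀ z, 0 ≤ θ z) (h1 : ∀ z, θ z ≤ 1)
    (ham : Measurable a) (hbm : Measurable b) (ha : ∀ p, |a p| ≤ 1) (hb : ∀ p, |b p| ≤ 1)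
    (hba : ∀ y y', b (y', y) = -b (y, y')) (x : X) :
    ∫ y, ∫ x', ∫ y', cornerKernel θ a b (x, y) (x', y') ∂ν ∂μ ∂ν = 0 := by
  have hm := measurable_cornerKernel hθ ham hbm
  have hle : ∀ z z', |cornerKernel θ a b z z'| ≤ 1 := fun z z' =>
    (abs_cornerKernel_le h0 h1 ha hb z z').trans (h1 z)
  have hi : Integrable (fun p : (Y × X) × Y => cornerKernel θ a b (x, p.1.1) (p.1.2, p.2))
      ((ν.prod μ).prod ν) :=
    integrable_of_mem_unit (hm.comp (show Measurable fun p : (Y × X) × Y =>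
      ((x, p.1.1), (p.1.2, p.2)) by fun_prop)) fun _ => hle _ _
  rw [integral_integral_swap hi.integral_prod_left]
  refine integral_eq_zero_of_ae (ae_of_all _ fun x' => ?_)
  refine integral_integral_eq_zero_of_antisymm
    (J := fun p : Y × Y => cornerKernel θ a b (x, p.1) (x', p.2)) ?_ (fun _ => hle _ _) ?_
  · exact hm.comp (show Measurable fun p : Y × Y => ((x, p.1), (x', p.2)) by fun_prop)
  · intro y y'
    simp only [cornerKernel, hba y y']
    ring

lemma integral_cornerKernel_snd (hθ : Measurable θ) (h0 : ∀ z, 0 ≤ θ z) (h1 : ∀ z, θ z ≤ 1)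
    (ham : Measurable a) (hbm : Measurable b) (ha : ∀ p, |a p| ≤ 1) (hb : ∀ p, |b p| ≤ 1)
    (haa : ∀ x x', a (x', x) = -a (x, x')) (y : Y) :
    ∫ x, ∫ x', ∫ y', cornerKernel θ a b (x, y) (x', y') ∂ν ∂μ ∂μ = 0 := by
  have hm := measurable_cornerKernel hθ ham hbm
  have hle : ∀ z z', |cornerKernel θ a b z z'| ≤ 1 := fun z z' =>
    (abs_cornerKernel_le h0 h1 ha hb z z').trans (h1 z)
  have hi : Integrable (fun p : (X × X) × Y => cornerKernel θ a b (p.1.1, y) (p.1.2, p.2))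
      ((μ.prod μ).prod ν) :=
    integrable_of_mem_unit (hm.comp (show Measurable fun p : (X × X) × Y =>
      ((p.1.1, y), (p.1.2, p.2)) by fun_prop)) fun _ => hle _ _
  have h := integral_integral_swap (f := fun x x' => ∫ y', cornerKernel θ a b (x, y) (x', y') ∂ν)
    hi.integral_prod_left
  have h2 : ∫ x', ∫ x, ∫ y', cornerKernel θ a b (x, y) (x', y') ∂ν ∂μ ∂μ =
      -∫ x, ∫ x', ∫ y', cornerKernel θ a b (x, y) (x', y') ∂ν ∂μ ∂μ := by
    simp only [← integral_neg]
    refine integral_congr_ae (ae_of_all _ fun x' => integral_congr_ae (ae_of_all _ fun x =>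
      integral_congr_ae (ae_of_all _ fun y' => ?_)))
    simp only [cornerKernel, haa x' x]
    ring
  linarith

/-- Integrating out `z'` gives an admissible perturbation: the factor `θ z` bounds it by a multiple
of `min k (1 - k)`, and antisymmetry kills both marginals. -/
lemma IsExtremalCoupling.ae_integral_cornerKernel_eq_zero {f : X → ℝ} {g : Y → ℝ} {k : X × Y → ℝ}
    (hk : IsExtremalCoupling μ ν f g k)
    (ham : Measurable a) (hbm : Measurable b) (ha : ∀ p, |a p| ≤ 1) (hb : ∀ p, |b p| ≤ 1)
    (haa : ∀ x x', a (x', x) = -a (x, x')) (hba : ∀ y y', b (y', y) = -b (y, y')) :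
    ∀ᵐ z ∂(μ.prod ν),
      ∫ z', cornerKernel (fun z => min (k z) (1 - k z)) a b z z' ∂(μ.prod ν) = 0 := by
  set θ : X × Y → ℝ := fun z => min (k z) (1 - k z)
  have hθ : Measurable θ := hk.measurable.min (measurable_const.sub hk.measurable)
  have h0 : ∀ z, 0 ≤ θ z := fun z => le_min (hk.nonneg z) (by linarith [hk.le_one z])
  have h1 : ∀ z, θ z ≤ 1 := fun z => (min_le_left _ _).trans (hk.le_one z)
  have hm := measurable_cornerKernel hθ ham hbm
  have hle := abs_cornerKernel_le h0 h1 ha hb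
  have hprod : ∀ z, ∫ z', cornerKernel θ a b z z' ∂(μ.prod ν) =
      ∫ x', ∫ y', cornerKernel θ a b z (x', y') ∂ν ∂μ := fun z =>
    integral_prod _ (integrable_fst_section hm (fun p => (hle p.1 p.2).trans (h1 p.1)) z)
  refine hk.extremal _ ((μ.prod ν).real Set.univ)
    hm.stronglyMeasurable.integral_prod_right'.measurable (fun z => ?_) (fun x => ?_) fun y => ?_
  · have := norm_integral_le_of_norm_le_const (μ := μ.prod ν) (f := cornerKernel θ a b z)
      (C := θ z) (ae_of_all _ fun z' => hle z z')
    rwa [mul_comm] at this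
  · simp only [hprod]
    exact integral_cornerKernel_fst hθ h0 h1 ham hbm ha hb hba x
  · simp only [hprod]
    exact integral_cornerKernel_snd hθ h0 h1 ham hbm ha hb haa y

end cornerKernel

/-- The antisymmetric function `1_A ⊗ 1_A' - 1_A' ⊗ 1_A`. -/
noncomputable def antiIndicator {Z : Type*} (A A' : Set Z) (p : Z × Z) : ℝ :=
  A.indicator 1 p.1 * A'.indicator 1 p.2 - A'.indicator 1 p.1 * A.indicator 1 p.2

section antiIndicator

variable {Z : Type*} {A A' : Set Z}

lemma measurable_antiIndicator [MeasurableSpace Z] (hA : MeasurableSet A)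
    (hA' : MeasurableSet A') : Measurable (antiIndicator A A') := by
  have h1 : Measurable (A.indicator (1 : Z → ℝ)) := measurable_one.indicator hA
  have h2 : Measurable (A'.indicator (1 : Z → ℝ)) := measurable_one.indicator hA'
  unfold antiIndicator
  fun_prop

lemma antiIndicator_swap (x x' : Z) :
    antiIndicator A A' (x', x) = -antiIndicator A A' (x, x') := by
  simp only [antiIndicator]; ring

lemma antiIndicator_of_mem (h : Disjoint A A') {x : Z} (hx : x ∈ A) (x' : Z) :
    antiIndicator A A' (x, x') = A'.indicator 1 x' := by
  simp [antiIndicator, hx, Set.disjoint_left.1 h hx]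

lemma abs_antiIndicator_le (h : Disjoint A A') (p : Z × Z) : |antiIndicator A A' p| ≤ 1 := by
  classical
  have := fun x (hx : x ∈ A) => Set.disjoint_left.1 h hx
  simp only [antiIndicator, Set.indicator, Pi.one_apply]
  by_cases h1 : p.1 ∈ A
  · by_cases h2 : p.2 ∈ A' <;> simp [h1, h2, this _ h1]
  · by_cases h2 : p.2 ∈ A <;> by_cases h3 : p.1 ∈ A' <;> simp [h1, h2, h3]

end antiIndicator

/-- All four corners of the rectangle with opposite vertices `z` and `z'` lie in `F`. -/
def CornersIn (F : Set (X × Y)) (z z' : X × Y) : Prop :=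
  z ∈ F ∧ (z.1, z'.2) ∈ F ∧ (z'.1, z.2) ∈ F ∧ z' ∈ F

/-- The set where `k` is neither `0` nor `1` (for `k` with values in `[0, 1]`). -/
def fractionalSet (k : X × Y → ℝ) : Set (X × Y) := {z | 0 < k z ∧ k z < 1}

/-- For `z` in `A × B` the antisymmetric factors reduce to the indicator of `A' × B'`. The kernel is
then nonnegative in `z'` with zero integral, yet strictly positive when all four corners are
fractional. -/
lemma IsExtremalCoupling.ae_not_cornersIn {μ : Measure X} {ν : Measure Y} [IsFiniteMeasure μ]
    [IsFiniteMeasure ν] {f : X → ℝ} {g : Y → ℝ} {k : X × Y → ℝ}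
    (hk : IsExtremalCoupling μ ν f g k) {A A' : Set X} {B B' : Set Y} (hA : MeasurableSet A)
    (hA' : MeasurableSet A') (hB : MeasurableSet B) (hB' : MeasurableSet B')
    (hAA' : Disjoint A A') (hBB' : Disjoint B B') :
    ∀ᵐ z ∂(μ.prod ν), ∀ᵐ z' ∂(μ.prod ν),
      z.1 ∈ A → z.2 ∈ B → z'.1 ∈ A' → z'.2 ∈ B' → ¬ CornersIn (fractionalSet k) z z' := by
  have ham := measurable_antiIndicator hA hA'
  have hbm := measurable_antiIndicator hB hB'
  have h0 : ∀ z, 0 ≤ min (k z) (1 - k z) :=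
    fun z => le_min (hk.nonneg z) (by linarith [hk.le_one z])
  have h1 : ∀ z, min (k z) (1 - k z) ≤ 1 := fun z => (min_le_left _ _).trans (hk.le_one z)
  have hpos : ∀ z ∈ fractionalSet k, 0 < min (k z) (1 - k z) :=
    fun z hz => lt_min hz.1 (by linarith [hz.2])
  filter_upwards [hk.ae_integral_cornerKernel_eq_zero ham hbm (abs_antiIndicator_le hAA')
    (abs_antiIndicator_le hBB') antiIndicator_swap antiIndicator_swap] with z hz
  by_cases hz1 : z.1 ∈ A
  swap; · exact ae_of_all _ fun _ h => absurd h hz1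
  by_cases hz2 : z.2 ∈ B
  swap; · exact ae_of_all _ fun _ _ h => absurd h hz2
  have hm : Measurable (fun z => min (k z) (1 - k z)) :=
    hk.measurable.min (measurable_const.sub hk.measurable)
  rw [integral_eq_zero_iff_of_nonneg] at hz
  · filter_upwards [hz] with z' hz' _ _ hA hB hc
    simp only [cornerKernel, antiIndicator_of_mem hAA' hz1, antiIndicator_of_mem hBB' hz2,
      Set.indicator_of_mem hA, Set.indicator_of_mem hB, Pi.one_apply, mul_one,
      Pi.zero_apply] at hz'
    have := mul_pos (hpos _ hc.1) (mul_pos (mul_pos (hpos _ hc.2.1) (hpos _ hc.2.2.1))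
      (hpos _ hc.2.2.2))
    exact this.ne' hz'
  · intro z'
    simp only [cornerKernel, antiIndicator_of_mem hAA' hz1, antiIndicator_of_mem hBB' hz2,
      Pi.zero_apply]
    exact mul_nonneg (mul_nonneg (h0 _) (mul_nonneg (mul_nonneg (h0 _) (h0 _)) (h0 _)))
      (mul_nonneg (Set.indicator_nonneg (fun _ _ => zero_le_one) _)
        (Set.indicator_nonneg (fun _ _ => zero_le_one) _))
  · exact integrable_fst_section (measurable_cornerKernel hm ham hbm)
      (fun p => (abs_cornerKernel_le h0 h1 (abs_antiIndicator_le hAA')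
        (abs_antiIndicator_le hBB') p.1 p.2).trans (h1 p.1)) z

/-! ### Fine partitions for nonatomic measures -/

lemma IsNonatomic.exists_subset_half {μ : Measure X} (h : IsNonatomic μ)
    {A : Set X} (hA : MeasurableSet A) (hpos : 0 < μ A) :
    ∃ B ⊆ A, MeasurableSet B ∧ 0 < μ B ∧ μ B ≤ μ A / 2 := by
  have h1 := h A
  simp only [IsAtomOf, hA, hpos, true_and, not_forall, not_or] at h1
  obtain ⟨B, hBA, hB, h2, h3⟩ := h1
  have hsum : μ B + μ (A \ B) = μ A := by
    rw [← measure_inter_add_sdiff A hB, Set.inter_eq_self_of_subset_right hBA]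
  by_cases h4 : μ B ≤ μ A / 2
  · exact ⟨B, hBA, hB, pos_iff_ne_zero.2 h2, h4⟩
  · refine ⟨A \ B, Set.sdiff_subset, hA.diff hB, pos_iff_ne_zero.2 h3, ?_⟩
    by_contra! h5
    have := ENNReal.add_lt_add (not_le.1 h4) h5
    rw [hsum, ENNReal.add_halves] at this
    exact lt_irrefl _ this

lemma IsNonatomic.exists_subset_le {μ : Measure X} [IsFiniteMeasure μ] (h : IsNonatomic μ)
    {A : Set X} (hA : MeasurableSet A) (hpos : 0 < μ A) {ε : ℝ≥0∞} (hε : ε ≠ 0) :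
    ∃ B ⊆ A, MeasurableSet B ∧ 0 < μ B ∧ μ B ≤ ε := by
  have key : ∀ n : ℕ, ∃ B ⊆ A, MeasurableSet B ∧ 0 < μ B ∧ μ B ≤ μ A * 2⁻¹ ^ n := by
    intro n
    induction n with
    | zero => exact ⟨A, subset_rfl, hA, hpos, by simp⟩
    | succ n ih =>
      obtain ⟨B, hBA, hB, hB0, hBle⟩ := ih
      obtain ⟨C, hCB, hC, hC0, hCle⟩ := h.exists_subset_half hB hB0
      refine ⟨C, hCB.trans hBA, hC, hC0, hCle.trans ?_⟩
      rw [pow_succ, ← mul_assoc, ENNReal.div_eq_inv_mul, mul_comm]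
      gcongr
  have hlim : Filter.Tendsto (fun n : ℕ => μ A * (2⁻¹ : ℝ≥0∞) ^ n) Filter.atTop (nhds 0) := by
    have := ENNReal.Tendsto.const_mul (a := μ A)
      (ENNReal.tendsto_pow_atTop_nhds_zero_of_lt_one (r := 2⁻¹) (by simp))
      (Or.inr (measure_ne_top μ A))
    simpa using this
  obtain ⟨n, hn⟩ := (hlim.eventually (gt_mem_nhds (pos_iff_ne_zero.2 hε))).exists
  obtain ⟨B, h1, h2, h3, h4⟩ := key n
  exact ⟨B, h1, h2, h3, h4.trans hn.le⟩

/-- Take a maximal disjoint family of sets of positive measure at most `ε`. It is countable because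
`μ` is finite, and what it misses is null, since otherwise another small piece would fit; the null
remainder becomes one more cell. -/
lemma IsNonatomic.exists_partition {μ : Measure X} [IsFiniteMeasure μ] (h : IsNonatomic μ)
    {ε : ℝ≥0∞} (hε : ε ≠ 0) :
    ∃ S : Set (Set X), S.Countable ∧ S.PairwiseDisjoint id ∧ ⋃₀ S = Set.univ ∧
      ∀ A ∈ S, MeasurableSet A ∧ μ A ≤ ε := by
  obtain ⟨S, hS⟩ := zorn_subset {S : Set (Set X) | S.PairwiseDisjoint id ∧
      ∀ A ∈ S, MeasurableSet A ∧ 0 < μ A ∧ μ A ≤ ε} (by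
    intro c hc hchain
    refine ⟨⋃₀ c, ⟨?_, ?_⟩, fun s hs => Set.subset_sUnion_of_mem hs⟩
    · exact (Set.pairwiseDisjoint_sUnion hchain.directedOn).2 fun s hs => (hc hs).1
    · rintro A ⟨s, hs, hA⟩
      exact (hc hs).2 A hA)
  obtain ⟨hdisj, hprop⟩ := hS.prop
  have hcount : S.Countable := by
    have h1 := Measure.countable_meas_pos_of_disjoint_iUnion (μ := μ)
      (As := fun A : S => (A : Set X)) (fun A => (hprop A A.2).1)
      (fun A B hAB => hdisj A.2 B.2 fun h => hAB (Subtype.ext h))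
    have h2 : {i : S | 0 < μ (i : Set X)} = Set.univ :=
      Set.eq_univ_of_forall fun A => (hprop A A.2).2.1
    rw [h2, Set.countable_univ_iff] at h1
    exact h1
  set R := (⋃₀ S)ᶜ with hR
  have hRm : MeasurableSet R := (MeasurableSet.sUnion hcount fun A hA => (hprop A hA).1).compl
  have hRdisj : ∀ A ∈ S, Disjoint R A := fun A hA =>
    Set.disjoint_left.2 fun x hx hxA => hx ⟨A, hA, hxA⟩
  have hR0 : μ R = 0 := by
    by_contra hne
    obtain ⟨B, hBR, hB, hB0, hBε⟩ := h.exists_subset_le hRm (pos_iff_ne_zero.2 hne) hε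
    have hins : insert B S ∈ {S : Set (Set X) | S.PairwiseDisjoint id ∧
        ∀ A ∈ S, MeasurableSet A ∧ 0 < μ A ∧ μ A ≤ ε} := by
      refine ⟨hdisj.insert fun A hA _ => (hRdisj A hA).mono_left hBR, ?_⟩
      rintro A (rfl | hA)
      · exact ⟨hB, hB0, hBε⟩
      · exact hprop A hA
    have hBS : B ∈ S := hS.le_of_ge hins (Set.subset_insert B S) (Set.mem_insert B S)
    have := (hRdisj B hBS).mono_left hBR
    rw [disjoint_self, Set.bot_eq_empty] at this
    simp [this] at hB0
  refine ⟨insert R S, hcount.insert R, hdisj.insert fun A hA _ => hRdisj A hA, ?_, ?_⟩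
  · rw [Set.sUnion_insert, hR, Set.compl_union_self]
  · rintro A (rfl | hA)
    · exact ⟨hRm, by simp [hR0]⟩
    · exact ⟨(hprop A hA).1, (hprop A hA).2.2⟩

/-! ### Both measures nonatomic -/

lemma measurableSet_fractionalSet {k : X × Y → ℝ} (hk : Measurable k) :
    MeasurableSet (fractionalSet k) :=
  (measurableSet_lt measurable_const hk).inter (measurableSet_lt hk measurable_const)

section
variable {μ : Measure X} {ν : Measure Y} [IsFiniteMeasure μ] [IsFiniteMeasure ν]

/-- A Fubini bootstrap used twice: if almost every point of a set certifies that this very set is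
null, then the set is null. First it shows that the sections over almost all pairs `x`, `x'` have
null intersection, then that almost every horizontal section is null. -/
lemma measure_eq_zero_of_ae_not_cornersIn {F : Set (X × Y)} (hF : MeasurableSet F)
    (h : ∀ᵐ z ∂(μ.prod ν), ∀ᵐ z' ∂(μ.prod ν), ¬ CornersIn F z z') : (μ.prod ν) F = 0 := by
  have h1 : ∀ᵐ x ∂μ, ∀ᵐ y ∂ν, (x, y) ∈ F → μ {x' | (x', y) ∈ F} = 0 := by
    filter_upwards [Measure.ae_ae_of_ae_prod h] with x hx
    have hD : MeasurableSet {p : X × Y | (x, p.2) ∈ F ∧ p ∈ F} :=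
      (hF.preimage (by fun_prop)).inter hF
    have hm : MeasurableSet {p : Y × X | (x, p.1) ∈ F → (p.2, p.1) ∈ F →
        ν {y' | (x, y') ∈ F ∧ (p.2, y') ∈ F} = 0} := by
      refine MeasurableSet.imp (hF.preimage (by fun_prop)) (MeasurableSet.imp
        (hF.preimage (by fun_prop)) (measurableSet_eq_fun ?_ measurable_const))
      exact (measurable_measure_prodMk_left hD).comp measurable_snd
    have h2 : ∀ᵐ y ∂ν, ∀ᵐ x' ∂μ, (x, y) ∈ F → (x', y) ∈ F →
        ν {y' | (x, y') ∈ F ∧ (x', y') ∈ F} = 0 := by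
      filter_upwards [hx] with y hy
      filter_upwards [Measure.ae_ae_of_ae_prod hy] with x' hx' hxy hx'y
      refine measure_eq_zero_iff_ae_notMem.2 ?_
      filter_upwards [hx'] with y' hy' hc
      exact hy' ⟨hxy, hc.1, hx'y, hc.2⟩
    rw [Measure.ae_ae_comm hm] at h2
    have h3 : ∀ᵐ x' ∂μ, ∀ᵐ y ∂ν, ¬ ((x, y) ∈ F ∧ (x', y) ∈ F) := by
      filter_upwards [h2] with x' hx'
      -- If the common section is not null, almost no `y` can lie in it, because such a `y` would
      -- make it null.
      by_cases h0 : ν {y' | (x, y') ∈ F ∧ (x', y') ∈ F} = 0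
      · exact measure_eq_zero_iff_ae_notMem.1 h0
      · filter_upwards [hx'] with y hy hc
        exact h0 (hy hc.1 hc.2)
    rw [Measure.ae_ae_comm ((hF.preimage (by fun_prop : Measurable fun p : X × Y =>
      (x, p.2))).inter hF).compl] at h3
    filter_upwards [h3] with y hy hxy
    refine measure_eq_zero_iff_ae_notMem.2 ?_
    filter_upwards [hy] with x' hx' hc
    exact hx' ⟨hxy, hc⟩
  rw [Measure.ae_ae_comm (p := fun x y => (x, y) ∈ F → μ {x' | (x', y) ∈ F} = 0)
    (hF.imp (measurableSet_eq_fun ((measurable_measure_prodMk_right hF).comp measurable_snd)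
      measurable_const))] at h1
  rw [Measure.prod_apply_symm hF, lintegral_eq_zero_iff (measurable_measure_prodMk_right hF)]
  filter_upwards [h1] with y hy
  by_contra h0
  refine h0 (measure_eq_zero_iff_ae_notMem.2 ?_)
  filter_upwards [hy] with x hx hxF
  exact h0 (hx hxF)

variable {f : X → ℝ} {g : Y → ℝ} {k : X × Y → ℝ}

/-- Cut both factors into cells of measure at most `1 / (n + 1)`. Distinct cells are disjoint, so
for almost every `z`, almost every `z'` completing a fractional rectangle shares a row cell or a
column cell with `z`. Such `z'` fill a cross whose measure tends to zero with `n`. -/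
lemma IsExtremalCoupling.fractionalSet_null_of_nonatomic (hk : IsExtremalCoupling μ ν f g k)
    (hμ : IsNonatomic μ) (hν : IsNonatomic ν) : (μ.prod ν) (fractionalSet k) = 0 := by
  refine measure_eq_zero_of_ae_not_cornersIn (measurableSet_fractionalSet hk.measurable) ?_
  have hε : ∀ n : ℕ, ((n : ℝ≥0∞) + 1)⁻¹ ≠ 0 := fun n => by simp
  choose S hSc hSd hSu hSp using fun n => hμ.exists_partition (hε n)
  choose T hTc hTd hTu hTp using fun n => hν.exists_partition (hε n)
  have key : ∀ᵐ z ∂(μ.prod ν), ∀ n, ∀ᵐ z' ∂(μ.prod ν), CornersIn (fractionalSet k) z z' →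
      (∃ A ∈ S n, z.1 ∈ A ∧ z'.1 ∈ A) ∨ ∃ B ∈ T n, z.2 ∈ B ∧ z'.2 ∈ B := by
    refine ae_all_iff.2 fun n => ?_
    have h1 : ∀ᵐ z ∂(μ.prod ν), ∀ A ∈ S n, ∀ A' ∈ S n, ∀ B ∈ T n, ∀ B' ∈ T n,
        ∀ᵐ z' ∂(μ.prod ν), A ≠ A' → B ≠ B' → z.1 ∈ A → z.2 ∈ B → z'.1 ∈ A' → z'.2 ∈ B' →
          ¬ CornersIn (fractionalSet k) z z' := by
      refine (ae_ball_iff (hSc n)).2 fun A hA => (ae_ball_iff (hSc n)).2 fun A' hA' =>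
        (ae_ball_iff (hTc n)).2 fun B hB => (ae_ball_iff (hTc n)).2 fun B' hB' => ?_
      by_cases hAA' : A = A'
      · exact ae_of_all _ fun _ => ae_of_all _ fun _ h => absurd hAA' h
      by_cases hBB' : B = B'
      · exact ae_of_all _ fun _ => ae_of_all _ fun _ _ h => absurd hBB' h
      filter_upwards [hk.ae_not_cornersIn (hSp n A hA).1 (hSp n A' hA').1 (hTp n B hB).1
        (hTp n B' hB').1 (hSd n hA hA' hAA') (hTd n hB hB' hBB')] with z hz
      filter_upwards [hz] with z' hz' _ _
      exact hz'
    filter_upwards [h1] with z hz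
    have h2 : ∀ᵐ z' ∂(μ.prod ν), ∀ A ∈ S n, ∀ A' ∈ S n, ∀ B ∈ T n, ∀ B' ∈ T n,
        A ≠ A' → B ≠ B' → z.1 ∈ A → z.2 ∈ B → z'.1 ∈ A' → z'.2 ∈ B' →
          ¬ CornersIn (fractionalSet k) z z' :=
      (ae_ball_iff (hSc n)).2 fun A hA => (ae_ball_iff (hSc n)).2 fun A' hA' =>
        (ae_ball_iff (hTc n)).2 fun B hB => (ae_ball_iff (hTc n)).2 fun B' hB' =>
          hz A hA A' hA' B hB B' hB'
    filter_upwards [h2] with z' hz' hc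
    by_contra! hcon
    obtain ⟨A, hA, hzA⟩ : z.1 ∈ ⋃₀ S n := hSu n ▸ Set.mem_univ _
    obtain ⟨A', hA', hzA'⟩ : z'.1 ∈ ⋃₀ S n := hSu n ▸ Set.mem_univ _
    obtain ⟨B, hB, hzB⟩ : z.2 ∈ ⋃₀ T n := hTu n ▸ Set.mem_univ _
    obtain ⟨B', hB', hzB'⟩ : z'.2 ∈ ⋃₀ T n := hTu n ▸ Set.mem_univ _
    refine hz' A hA A' hA' B hB B' hB' ?_ ?_ hzA hzB hzA' hzB' hc
    · rintro rfl; exact hcon.1 A hA hzA hzA'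
    · rintro rfl; exact hcon.2 B hB hzB hzB'
  filter_upwards [key] with z hz
  change (μ.prod ν) {z' | ¬¬ CornersIn (fractionalSet k) z z'} = 0
  simp only [not_not]
  have hbound : ∀ n : ℕ, (μ.prod ν) {z' | CornersIn (fractionalSet k) z z'} ≤
      (ν Set.univ + μ Set.univ) * ((n : ℝ≥0∞) + 1)⁻¹ := by
    intro n
    obtain ⟨A, hA, hzA⟩ : z.1 ∈ ⋃₀ S n := hSu n ▸ Set.mem_univ _
    obtain ⟨B, hB, hzB⟩ : z.2 ∈ ⋃₀ T n := hTu n ▸ Set.mem_univ _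
    calc (μ.prod ν) {z' | CornersIn (fractionalSet k) z z'}
        ≤ (μ.prod ν) (A ×ˢ Set.univ ∪ Set.univ ×ˢ B) := by
          refine measure_mono_ae ?_
          filter_upwards [hz n] with z' hz' hc
          rcases hz' hc with ⟨A₁, hA₁, h1, h2⟩ | ⟨B₁, hB₁, h1, h2⟩
          · have : A₁ = A := (hSd n).elim_set hA₁ hA z.1 h1 hzA
            exact Or.inl ⟨this ▸ h2, trivial⟩
          · have : B₁ = B := (hTd n).elim_set hB₁ hB z.2 h1 hzB
            exact Or.inr ⟨trivial, this ▸ h2⟩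
      _ ≤ μ A * ν Set.univ + μ Set.univ * ν B := by
          refine (measure_union_le _ _).trans ?_
          rw [Measure.prod_prod, Measure.prod_prod]
      _ ≤ ((n : ℝ≥0∞) + 1)⁻¹ * ν Set.univ + μ Set.univ * ((n : ℝ≥0∞) + 1)⁻¹ := by
          gcongr
          · exact (hSp n A hA).2
          · exact (hTp n B hB).2
      _ = _ := by ring
  have hlim : Filter.Tendsto (fun n : ℕ => (ν Set.univ + μ Set.univ) * ((n : ℝ≥0∞) + 1)⁻¹)
      Filter.atTop (nhds 0) := by
    have h1 : Filter.Tendsto (fun n : ℕ => ((n : ℝ≥0∞) + 1)⁻¹) Filter.atTop (nhds 0) := by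
      have := (Filter.tendsto_add_atTop_iff_nat 1).2 ENNReal.tendsto_inv_nat_nhds_zero
      simpa using this
    simpa using ENNReal.Tendsto.const_mul (a := ν Set.univ + μ Set.univ) h1
      (Or.inr (ENNReal.add_ne_top.2 ⟨measure_ne_top _ _, measure_ne_top _ _⟩))
  exact le_antisymm (ge_of_tendsto' hlim hbound) zero_le

end

/-! ### From an integral coupling to a set -/

/-- There is a measurable set with vertical sections `f` and horizontal sections `g`. -/
def HasSectionSet (μ : Measure X) (ν : Measure Y) (f : X → ℝ) (g : Y → ℝ) : Prop :=
  ∃ E : Set (X × Y), MeasurableSet E ∧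
    (∀ᵐ x ∂μ, vertSection ν E x = ENNReal.ofReal (f x)) ∧
    (∀ᵐ y ∂ν, horizSection μ E y = ENNReal.ofReal (g y))

lemma IsCoupling.hasSectionSet {μ : Measure X} {ν : Measure Y} [IsFiniteMeasure μ]
    [IsFiniteMeasure ν] {f : X → ℝ} {g : Y → ℝ} {k : X × Y → ℝ} (hk : IsCoupling μ ν f g k)
    (h0 : (μ.prod ν) (fractionalSet k) = 0) : HasSectionSet μ ν f g := by
  have hE : MeasurableSet {z | 1 / 2 < k z} := measurableSet_lt measurable_const hk.measurable
  have hk1 : ∀ z, |k z| ≤ 1 := fun z => by rw [abs_of_nonneg (hk.nonneg z)]; exact hk.le_one z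
  have hae : ∀ᵐ z ∂(μ.prod ν), {z | 1 / 2 < k z}.indicator (fun _ => (1 : ℝ≥0∞)) z =
      ENNReal.ofReal (k z) := by
    filter_upwards [measure_eq_zero_iff_ae_notMem.1 h0] with z hz
    rcases (hk.nonneg z).eq_or_lt with h | h
    · rw [Set.indicator_of_notMem (by simp [← h]), ← h, ENNReal.ofReal_zero]
    · have : k z = 1 := le_antisymm (hk.le_one z) (not_lt.1 fun h1 => hz ⟨h, h1⟩)
      rw [Set.indicator_of_mem (by norm_num [this]), this, ENNReal.ofReal_one]
  have hx := Measure.ae_ae_of_ae_prod hae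
  have hy := (Measure.ae_ae_comm (p := fun x y => {z | 1 / 2 < k z}.indicator
    (fun _ => (1 : ℝ≥0∞)) (x, y) = ENNReal.ofReal (k (x, y))) (measurableSet_eq_fun
      (measurable_const.indicator hE) hk.measurable.ennreal_ofReal)).1 hx
  refine ⟨{z | 1 / 2 < k z}, hE, ?_, ?_⟩
  · filter_upwards [hx, hk.fst] with x h1 h2
    rw [vertSection, lintegral_congr_ae h1, ← h2, ofReal_integral_eq_lintegral_ofReal
      (integrable_fst_section hk.measurable hk1 x) (ae_of_all _ fun y => hk.nonneg _)]
  · filter_upwards [hy, hk.snd] with y h1 h2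
    rw [horizSection, lintegral_congr_ae h1, ← h2, ofReal_integral_eq_lintegral_ofReal
      (integrable_snd_section hk.measurable hk1 y) (ae_of_all _ fun x => hk.nonneg _)]

/-! ### Finite factors and integral sums -/

/-- If all other entries were `0` or `1`, the entry at `j` would be an integer strictly between `0`
and `1`. -/
lemma exists_ne_fractional {ι : Type*} [Fintype ι] {q : ι → ℝ} (h0 : ∀ i, 0 ≤ q i)
    (h1 : ∀ i, q i ≤ 1) {m : ℕ} (hsum : ∑ i, q i = m) {j : ι} (hj : 0 < q j ∧ q j < 1) :
    ∃ l, l ≠ j ∧ 0 < q l ∧ q l < 1 := by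
  classical
  by_contra! hcon
  have hint : ∀ l, l ≠ j → ∃ e : ℤ, q l = e := by
    intro l hl
    rcases (h0 l).eq_or_lt with h | h
    · exact ⟨0, by simp [← h]⟩
    · exact ⟨1, by simpa using le_antisymm (h1 l) (hcon l hl h)⟩
  choose! e he using hint
  rw [← Finset.add_sum_erase _ _ (Finset.mem_univ j),
    Finset.sum_congr rfl fun l hl => he l (Finset.ne_of_mem_erase hl), ← Int.cast_sum] at hsum
  set s := ∑ l ∈ Finset.univ.erase j, e l
  have h2 : q j = ((m - s : ℤ) : ℝ) := by push_cast; linarith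
  rw [h2] at hj
  have h3 : 0 < (m - s : ℤ) := by exact_mod_cast hj.1
  have h4 : (m - s : ℤ) < 1 := by exact_mod_cast hj.2
  omega

section
variable {n : ℕ} {μ : Measure X} {ν : Measure (Fin n)} [IsFiniteMeasure μ] [IsFiniteMeasure ν]
  {f : X → ℝ} {g : Fin n → ℝ} {k : X × Fin n → ℝ} {c : ℝ≥0∞}

lemma sum_eq_of_integral_eq (hc : c.toReal ≠ 0) (hν : ∀ j, ν {j} = c) {q : Fin n → ℝ} {r : ℝ}
    {m : ℕ} (hr : r = m * c.toReal) (h : ∫ j, q j ∂ν = r) : ∑ j, q j = m := by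
  rw [integral_fintype Integrable.of_finite, hr] at h
  simp only [measureReal_def, hν, smul_eq_mul, ← Finset.mul_sum] at h
  rw [mul_comm] at h
  exact mul_right_cancel₀ hc h

/-- If the points `x` fractional in two given columns had positive measure, the corner argument
would forbid splitting them into two positive pieces, making them an atom. So almost every `x` has
at most one fractional entry, and the integral sum excludes exactly one. -/
lemma IsExtremalCoupling.fractionalSet_null_of_nonatomic_fin (hk : IsExtremalCoupling μ ν f g k)
    (hμ : IsNonatomic μ) (hc : c ≠ 0) (hc' : c ≠ ∞) (hν : ∀ j, ν {j} = c)
    (hf : ∀ᵐ x ∂μ, ∃ m : ℕ, f x = m * c.toReal) : (μ.prod ν) (fractionalSet k) = 0 := by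
  have hFm := measurableSet_fractionalSet hk.measurable
  have hQ : ∀ j l, j ≠ l →
      ∀ᵐ x ∂μ, ¬ ((x, j) ∈ fractionalSet k ∧ (x, l) ∈ fractionalSet k) := by
    intro j l hjl
    set Q := {x | (x, j) ∈ fractionalSet k ∧ (x, l) ∈ fractionalSet k}
    have hQm : MeasurableSet Q :=
      (hFm.preimage (by fun_prop : Measurable fun x : X => (x, j))).inter
        (hFm.preimage (by fun_prop : Measurable fun x : X => (x, l)))
    have hatom := hμ Q
    refine (measure_eq_zero_iff_ae_notMem (s := Q)).1 ?_
    by_contra hpos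
    refine hatom ⟨hQm, pos_iff_ne_zero.2 hpos, fun B hB hBm => ?_⟩
    have h1 := hk.ae_not_cornersIn hBm (hQm.diff hBm) (measurableSet_singleton j)
      (measurableSet_singleton l) Set.disjoint_sdiff_right (by simpa using hjl)
    have hνj : ∀ i, ν {i} ≠ 0 := fun i => by rwa [hν i]
    have h2 : ∀ᵐ x ∂μ, x ∈ B → μ (Q \ B) = 0 := by
      filter_upwards [Measure.ae_ae_of_ae_prod h1] with x hx hxB
      have hx := Measure.ae_ae_of_ae_prod (ae_iff_of_countable.1 hx j (hνj j))
      refine measure_eq_zero_iff_ae_notMem.2 ?_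
      filter_upwards [hx] with x' hx' hxQ
      exact ae_iff_of_countable.1 hx' l (hνj l) hxB rfl hxQ rfl
        ⟨(hB hxB).1, (hB hxB).2, hxQ.1.1, hxQ.1.2⟩
    by_cases h3 : μ (Q \ B) = 0
    · exact Or.inr h3
    · refine Or.inl (measure_eq_zero_iff_ae_notMem.2 ?_)
      filter_upwards [h2] with x hx hxB
      exact h3 (hx hxB)
  have hall : ∀ᵐ x ∂μ, ∀ j l, j ≠ l →
      ¬ ((x, j) ∈ fractionalSet k ∧ (x, l) ∈ fractionalSet k) := by
    refine ae_all_iff.2 fun j => ae_all_iff.2 fun l => ?_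
    by_cases hjl : j = l
    · exact ae_of_all _ fun _ h => absurd hjl h
    · filter_upwards [hQ j l hjl] with x hx _ using hx
  refine (Measure.measure_prod_null hFm).2 ?_
  filter_upwards [hall, hk.fst, hf] with x h1 h2 ⟨m, hm⟩
  have hempty : Prod.mk x ⁻¹' fractionalSet k = ∅ := by
    refine Set.eq_empty_of_forall_notMem fun j hj => ?_
    obtain ⟨l, hlj, hl⟩ := exists_ne_fractional (fun i => hk.nonneg (x, i))
      (fun i => hk.le_one (x, i))
      (sum_eq_of_integral_eq (ENNReal.toReal_ne_zero.2 ⟨hc, hc'⟩) hν hm h2) hj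
    exact h1 l j hlj ⟨hl, hj⟩
  rw [hempty, measure_empty, Pi.zero_apply]

end

/-- If every row and column of a finite bipartite edge set which meets it contains at least two
edges, then there is a nonzero edge weight with vanishing row and column sums. -/
lemma exists_ne_zero_sum_eq_zero {α β : Type*} [Fintype α] [Fintype β] [DecidableEq α]
    [DecidableEq β] (F : Finset (α × β)) (hne : F.Nonempty)
    (hrow : ∀ p ∈ F, ∃ b, b ≠ p.2 ∧ (p.1, b) ∈ F) (hcol : ∀ p ∈ F, ∃ a, a ≠ p.1 ∧ (a, p.2) ∈ F) :
    ∃ h : α × β → ℝ, h ≠ 0 ∧ (∀ p ∉ F, h p = 0) ∧ (∀ a, ∑ b, h (a, b) = 0) ∧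
      ∀ b, ∑ a, h (a, b) = 0 := by
  set R := F.image Prod.fst
  set C := F.image Prod.snd
  have hR : R.card * 2 ≤ F.card := by
    rw [mul_comm]
    refine Finset.mul_card_image_le_card F 2 fun a ha => ?_
    obtain ⟨p, hp, rfl⟩ := Finset.mem_image.1 ha
    obtain ⟨b, hb, hbF⟩ := hrow p hp
    refine Finset.one_lt_card.2 ⟨p, by simp [hp], (p.1, b), by simp [hbF], fun h => hb ?_⟩
    rw [h]
  have hC : C.card * 2 ≤ F.card := by
    rw [mul_comm]
    refine Finset.mul_card_image_le_card F 2 fun b hb => ?_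
    obtain ⟨p, hp, rfl⟩ := Finset.mem_image.1 hb
    obtain ⟨a, ha, haF⟩ := hcol p hp
    refine Finset.one_lt_card.2 ⟨p, by simp [hp], (a, p.2), by simp [haF], fun h => ha ?_⟩
    rw [h]
  obtain ⟨p₀, hp₀⟩ := hne
  have hb₀ : p₀.2 ∈ C := Finset.mem_image_of_mem _ hp₀
  -- The constraints are row sums, column sums and vanishing off `F`. Two edges per row and per
  -- column give `|R| + |C| ≤ |F|`, and omitting one redundant column sum makes the count strictly
  -- smaller than the number of unknowns.
  let T : (α × β → ℝ) →ₗ[ℝ]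
      (R → ℝ) × ((C.erase p₀.2 : Finset β) → ℝ) × ((Fᶜ : Finset (α × β)) → ℝ) :=
    { toFun := fun h => (fun a => ∑ b, h (a, b), fun b => ∑ a, h (a, b), fun p => h p)
      map_add' := fun h h' => by
        ext <;> simp [Finset.sum_add_distrib]
      map_smul' := fun r h => by
        ext <;> simp [Finset.mul_sum] }
  have hlt : Module.finrank ℝ ((R → ℝ) × ((C.erase p₀.2 : Finset β) → ℝ) ×
      ((Fᶜ : Finset (α × β)) → ℝ)) < Module.finrank ℝ (α × β → ℝ) := by
    simp only [Module.finrank_prod, Module.finrank_fintype_fun_eq_card, Fintype.card_coe,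
      Finset.card_compl, Finset.card_erase_of_mem hb₀]
    have h1 := F.card_le_univ
    have h2 := Finset.card_pos.2 ⟨_, hb₀⟩
    omega
  obtain ⟨h, hker, hh⟩ := (Submodule.ne_bot_iff _).1 (LinearMap.ker_ne_bot_of_finrank_lt (f := T) hlt)
  have hT : T h = 0 := hker
  have hF0 : ∀ p ∉ F, h p = 0 := fun p hp =>
    congrFun (congrArg (fun w => w.2.2) hT) ⟨p, Finset.mem_compl.2 hp⟩
  have hrow0 : ∀ a, ∑ b, h (a, b) = 0 := fun a => by
    by_cases ha : a ∈ R
    · exact congrFun (congrArg (fun w => w.1) hT) ⟨a, ha⟩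
    · exact Finset.sum_eq_zero fun b _ => hF0 _ fun hF => ha (Finset.mem_image_of_mem Prod.fst hF)
  have hcol0 : ∀ b, b ≠ p₀.2 → ∑ a, h (a, b) = 0 := fun b hb => by
    by_cases hbC : b ∈ C
    · exact congrFun (congrArg (fun w => w.2.1) hT) ⟨b, Finset.mem_erase.2 ⟨hb, hbC⟩⟩
    · exact Finset.sum_eq_zero fun a _ => hF0 _ fun hF => hbC (Finset.mem_image_of_mem Prod.snd hF)
  refine ⟨h, hh, hF0, hrow0, fun b => ?_⟩
  by_cases hb : b = p₀.2
  · have h1 : ∑ b, ∑ a, h (a, b) = 0 := by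
      rw [Finset.sum_comm]
      exact Finset.sum_eq_zero fun a _ => hrow0 a
    rw [Finset.sum_eq_single p₀.2 (fun b _ hb => hcol0 b hb) (by simp)] at h1
    rw [hb, h1]
  · exact hcol0 b hb

lemma IsExtremalCoupling.fractionalSet_null_of_fin {p n : ℕ} {μ : Measure (Fin p)}
    {ν : Measure (Fin n)} [IsFiniteMeasure μ] [IsFiniteMeasure ν] {f : Fin p → ℝ} {g : Fin n → ℝ}
    {k : Fin p × Fin n → ℝ} {c d : ℝ≥0∞} (hk : IsExtremalCoupling μ ν f g k)
    (hc : c ≠ 0) (hc' : c ≠ ∞) (hd : d ≠ 0) (hd' : d ≠ ∞)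
    (hμ : ∀ i, μ {i} = d) (hν : ∀ j, ν {j} = c)
    (hf : ∀ᵐ x ∂μ, ∃ m : ℕ, f x = m * c.toReal) (hg : ∀ᵐ y ∂ν, ∃ m : ℕ, g y = m * d.toReal) :
    (μ.prod ν) (fractionalSet k) = 0 := by
  classical
  set F : Finset (Fin p × Fin n) := Finset.univ.filter (· ∈ fractionalSet k)
  have hμ0 : ∀ i, μ {i} ≠ 0 := fun i => by rwa [hμ]
  have hν0 : ∀ i, ν {i} ≠ 0 := fun i => by rwa [hν]
  rcases F.eq_empty_or_nonempty with hF | hF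
  · have : fractionalSet k = ∅ := by
      refine Set.eq_empty_of_forall_notMem fun z hz => ?_
      have : z ∈ F := by simpa [F] using hz
      simp [hF] at this
    rw [this, measure_empty]
  exfalso
  obtain ⟨h, hne, hF0, hrow, hcol⟩ := exists_ne_zero_sum_eq_zero F hF
    (fun z hz => by
      have hz : z ∈ fractionalSet k := by simpa [F] using hz
      obtain ⟨m, hm⟩ := ae_iff_of_countable.1 hf z.1 (hμ0 _)
      obtain ⟨l, hl, hlF⟩ := exists_ne_fractional (fun i => hk.nonneg (z.1, i))
        (fun i => hk.le_one (z.1, i)) (sum_eq_of_integral_eq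
          (ENNReal.toReal_ne_zero.2 ⟨hc, hc'⟩) hν hm
          (ae_iff_of_countable.1 hk.fst z.1 (hμ0 _))) (j := z.2) hz
      exact ⟨l, hl, Finset.mem_filter.2 ⟨Finset.mem_univ _, hlF⟩⟩)
    (fun z hz => by
      have hz : z ∈ fractionalSet k := by simpa [F] using hz
      obtain ⟨m, hm⟩ := ae_iff_of_countable.1 hg z.2 (hν0 _)
      obtain ⟨l, hl, hlF⟩ := exists_ne_fractional (fun i => hk.nonneg (i, z.2))
        (fun i => hk.le_one (i, z.2)) (sum_eq_of_integral_eq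
          (ENNReal.toReal_ne_zero.2 ⟨hd, hd'⟩) hμ hm
          (ae_iff_of_countable.1 hk.snd z.2 (hν0 _))) (j := z.1) hz
      exact ⟨l, hl, Finset.mem_filter.2 ⟨Finset.mem_univ _, hlF⟩⟩)
  have h0 : ∀ z, 0 ≤ min (k z) (1 - k z) :=
    fun z => le_min (hk.nonneg z) (by linarith [hk.le_one z])
  -- The constant sums the ratios of `|h|` to `min k (1 - k)` over `F`, hence dominates each of
  -- them; off `F` the weight is zero.
  have hz0 := hk.extremal h (∑ z ∈ F, |h z| / min (k z) (1 - k z)) (measurable_of_finite h)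
    (fun z => by
      by_cases hz : z ∈ F
      · have hz' : z ∈ fractionalSet k := by simpa [F] using hz
        rw [← div_le_iff₀ (lt_min hz'.1 (by linarith [hz'.2]))]
        exact Finset.single_le_sum (f := fun z => |h z| / min (k z) (1 - k z))
          (fun z _ => div_nonneg (abs_nonneg _) (h0 z)) hz
      · rw [hF0 z hz, abs_zero]
        exact mul_nonneg (Finset.sum_nonneg fun z _ => div_nonneg (abs_nonneg _) (h0 z)) (h0 z))
    (fun x => by
      rw [integral_fintype Integrable.of_finite]
      simp only [measureReal_def, hν, smul_eq_mul, ← Finset.mul_sum, hrow, mul_zero])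
    (fun y => by
      rw [integral_fintype Integrable.of_finite]
      simp only [measureReal_def, hμ, smul_eq_mul, ← Finset.mul_sum, hcol, mul_zero])
  refine hne (funext fun z => ae_iff_of_countable.1 hz0 z ?_)
  rw [← Set.singleton_prod_singleton, Measure.prod_prod]
  exact mul_ne_zero (hμ0 _) (hν0 _)

/-! ### Equiatomic measures as finite sets of equal point masses -/

/-- On an atom every event `f ∈ U` is null or has null complement, and measurable sets separate
points of the real line. -/
lemma IsAtomOf.ae_eq_const {μ : Measure X} {A : Set X} (hA : IsAtomOf μ A) {f : X → ℝ}
    (hf : Measurable f) : ∃ r, ∀ᵐ x ∂μ, x ∈ A → f x = r := by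
  obtain ⟨r, hr⟩ := Filter.exists_eventuallyEq_const_of_forall_separating
    (l := ae (μ.restrict A)) (f := f) MeasurableSet fun U hU => by
      rw [ae_restrict_iff' hA.1, ae_restrict_iff' hA.1]
      rcases hA.2.2 (A ∩ f ⁻¹' U) Set.inter_subset_left (hA.1.inter (hf hU)) with h | h
      · right
        filter_upwards [measure_eq_zero_iff_ae_notMem.1 h] with x hx hxA hxU
        exact hx ⟨hxA, hxU⟩
      · left
        filter_upwards [measure_eq_zero_iff_ae_notMem.1 h] with x hx hxA
        by_contra hxU
        exact hx ⟨hxA, fun h => hxU h.2⟩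
  exact ⟨r, (ae_restrict_iff' hA.1).1 hr⟩

/-- `π` identifies `μ`, up to null sets, with the measure on `Fin n` all of whose points have
mass `c`. -/
structure IsDiscretization (μ : Measure X) {n : ℕ} (π : X → Fin n) (c : ℝ≥0∞) : Prop where
  measurable : Measurable π
  ne_zero : c ≠ 0
  ne_top : c ≠ ∞
  map_singleton : ∀ i, μ.map π {i} = c
  factor : ∀ f : X → ℝ, Measurable f → ∃ f' : Fin n → ℝ, f =ᵐ[μ] f' ∘ π

/-- A maximal disjoint family of atoms is finite because its members share one positive mass inside
a finite measure; a remainder of positive measure would contain a further atom. -/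
lemma IsEquiatomic.exists_atom_partition {μ : Measure X} [IsFiniteMeasure μ]
    (h : IsEquiatomic μ) : ∃ S : Set (Set X), S.Finite ∧ S.PairwiseDisjoint id ∧
      (∀ A ∈ S, IsAtomOf μ A) ∧ μ (⋃₀ S)ᶜ = 0 := by
  obtain ⟨S, hS⟩ := zorn_subset {S : Set (Set X) | S.PairwiseDisjoint id ∧
      ∀ A ∈ S, IsAtomOf μ A} (by
    intro c hc hchain
    refine ⟨⋃₀ c, ⟨?_, ?_⟩, fun s hs => Set.subset_sUnion_of_mem hs⟩
    · exact (Set.pairwiseDisjoint_sUnion hchain.directedOn).2 fun s hs => (hc hs).1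
    · rintro A ⟨s, hs, hA⟩
      exact (hc hs).2 A hA)
  obtain ⟨hdisj, hprop⟩ := hS.prop
  have hfin : S.Finite := by
    rcases S.eq_empty_or_nonempty with rfl | ⟨A₀, hA₀⟩
    · exact Set.finite_empty
    have h1 := Measure.finite_const_le_meas_of_disjoint_iUnion μ (hprop A₀ hA₀).2.1
      (As := fun A : S => (A : Set X)) (fun A => (hprop A A.2).1)
      (fun A B hAB => hdisj A.2 B.2 fun h => hAB (Subtype.ext h)) (measure_ne_top _ _)
    have h2 : {i : S | μ A₀ ≤ μ (i : Set X)} = Set.univ :=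
      Set.eq_univ_of_forall fun A => (h.2 _ _ (hprop A₀ hA₀) (hprop A A.2)).le
    rw [h2, Set.finite_univ_iff] at h1
    exact h1
  refine ⟨S, hfin, hdisj, hprop, ?_⟩
  by_contra hne
  have hRm : MeasurableSet (⋃₀ S)ᶜ :=
    (MeasurableSet.sUnion hfin.countable fun A hA => (hprop A hA).1).compl
  obtain ⟨B, hBR, hB⟩ := h.1 _ hRm (pos_iff_ne_zero.2 hne)
  have hBdisj : ∀ A ∈ S, Disjoint B A := fun A hA =>
    Set.disjoint_left.2 fun x hx hxA => hBR hx ⟨A, hA, hxA⟩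
  have hins : insert B S ∈ {S : Set (Set X) | S.PairwiseDisjoint id ∧
      ∀ A ∈ S, IsAtomOf μ A} := by
    refine ⟨hdisj.insert fun A hA _ => hBdisj A hA, ?_⟩
    rintro A (rfl | hA)
    · exact hB
    · exact hprop A hA
  have hBS : B ∈ S := hS.le_of_ge hins (Set.subset_insert B S) (Set.mem_insert B S)
  have := hBdisj B hBS
  rw [disjoint_self, Set.bot_eq_empty] at this
  have h0 := hB.2.1
  simp [this] at h0

lemma IsEquiatomic.exists_isDiscretization {μ : Measure X} [IsFiniteMeasure μ]
    (h : IsEquiatomic μ) (hμ : μ ≠ 0) :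
    ∃ (n : ℕ) (π : X → Fin n) (c : ℝ≥0∞), IsDiscretization μ π c := by
  classical
  obtain ⟨S, hfin, hdisj, hatom, hnull⟩ := h.exists_atom_partition
  have : Finite S := hfin
  obtain ⟨n, ⟨e⟩⟩ := Finite.exists_equiv_fin S
  let A : Fin n → Set X := fun i => (e.symm i : Set X)
  have hA : ∀ i, IsAtomOf μ (A i) := fun i => hatom _ (e.symm i).2
  have hAdisj : ∀ {i j x}, x ∈ A i → x ∈ A j → i = j := by
    intro i j x hi hj
    exact e.symm.injective (Subtype.ext (hdisj.elim_set (e.symm i).2 (e.symm j).2 x hi hj))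
  have hcover : ∀ᵐ x ∂μ, ∃ i, x ∈ A i := by
    filter_upwards [measure_eq_zero_iff_ae_notMem.1 hnull] with x hx
    obtain ⟨B, hB, hxB⟩ := not_not.1 hx
    exact ⟨e ⟨B, hB⟩, by simpa [A] using hxB⟩
  -- This is where `μ ≠ 0` matters: an atom must exist to serve as the value of `π` on the null set
  -- off all atoms.
  obtain ⟨i₀⟩ : Nonempty (Fin n) := by
    have : (ae μ).NeBot := ae_neBot.2 hμ
    obtain ⟨x, i, -⟩ := hcover.exists
    exact ⟨i⟩
  let π : X → Fin n := fun x => if hx : ∃ i, x ∈ A i then hx.choose else i₀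
  have hπ : ∀ {i x}, x ∈ A i → π x = i := by
    intro i x hx
    have hex : ∃ i, x ∈ A i := ⟨i, hx⟩
    simp only [π, dif_pos hex]
    exact hAdisj hex.choose_spec hx
  have hπ_ae : ∀ i, π ⁻¹' {i} =ᵐ[μ] A i := by
    intro i
    filter_upwards [hcover] with x ⟨j, hj⟩
    have h1 : π x = j := hπ hj
    refine propext ⟨fun hx => ?_, fun hx => hπ hx⟩
    have h2 : π x = i := hx
    have h3 : x ∈ A i := by rwa [← h2, h1]
    exact h3
  have hπm : Measurable π := by
    refine measurable_to_countable' fun i => ?_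
    have hUm : MeasurableSet (⋃ i, A i) := MeasurableSet.iUnion fun i => (hA i).1
    have : π ⁻¹' {i} = A i ∪ ((⋃ i, A i)ᶜ ∩ {_x | i₀ = i}) := by
      ext x
      by_cases hx : ∃ j, x ∈ A j
      · obtain ⟨j, hj⟩ := hx
        have hU : x ∈ ⋃ i, A i := Set.mem_iUnion.2 ⟨j, hj⟩
        simp only [Set.mem_preimage, Set.mem_singleton_iff, hπ hj, Set.mem_union, Set.mem_inter_iff,
          Set.mem_compl_iff, hU, not_true, false_and, or_false]
        exact ⟨fun h => h ▸ hj, fun h => hAdisj hj h⟩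
      · have hU : x ∉ ⋃ i, A i := fun h => hx (Set.mem_iUnion.1 h)
        have hi : x ∉ A i := fun h => hx ⟨i, h⟩
        simp only [Set.mem_preimage, π, dif_neg hx, Set.mem_singleton_iff, Set.mem_union, hi,
          Set.mem_inter_iff, Set.mem_compl_iff, hU, not_false_iff, true_and, false_or]
        rfl
    rw [this]
    exact (hA i).1.union (hUm.compl.inter (MeasurableSet.const _))
  refine ⟨n, π, μ (A i₀), hπm, (hA i₀).2.1.ne', measure_ne_top _ _, fun i => ?_, fun f hf => ?_⟩
  · rw [Measure.map_apply hπm (measurableSet_singleton i), measure_congr (hπ_ae i)]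
    exact h.2 _ _ (hA i) (hA i₀)
  · choose r hr using fun i => (hA i).ae_eq_const hf
    refine ⟨r, ?_⟩
    filter_upwards [hcover, ae_all_iff.2 hr] with x ⟨i, hi⟩ hx
    rw [Function.comp_apply, hπ hi, hx i hi]

section IsDiscretization

variable {μ : Measure X} {n : ℕ} {π : X → Fin n} {c : ℝ≥0∞}

/-- The indicator of a measurable set factors through `π`, so up to a null set the set is a union of
fibres, each of mass `c`. -/
lemma IsDiscretization.exists_eq_mul (h : IsDiscretization μ π c) {r : ℝ} (hr : 0 ≤ r)
    (hval : IsMeasureValue μ r) : ∃ m : ℕ, r = m * c.toReal := by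
  classical
  obtain ⟨A, hA, hAr⟩ := hval
  obtain ⟨q, hq⟩ := h.factor (A.indicator 1) (measurable_one.indicator hA)
  let B : Finset (Fin n) := Finset.univ.filter fun i => q i = 1
  have hAB : A =ᵐ[μ] π ⁻¹' (B : Set (Fin n)) := by
    filter_upwards [hq] with x hx
    refine propext ?_
    change x ∈ A ↔ x ∈ π ⁻¹' (B : Set (Fin n))
    rw [Function.comp_apply] at hx
    by_cases hxA : x ∈ A
    · rw [Set.indicator_of_mem hxA] at hx
      simp [B, hxA, ← hx]
    · rw [Set.indicator_of_notMem hxA] at hx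
      simp [B, hxA, ← hx]
  refine ⟨B.card, ?_⟩
  have h1 : μ A = B.card * c := by
    rw [measure_congr hAB, ← Measure.map_apply h.measurable B.measurableSet,
      ← sum_measure_singleton]
    simp [h.map_singleton]
  rw [← ENNReal.toReal_ofReal hr, ← hAr, h1, ENNReal.toReal_mul, ENNReal.toReal_natCast]

lemma IsDiscretization.forall_of_ae (h : IsDiscretization μ π c) {p : Fin n → Prop}
    (hp : ∀ᵐ x ∂μ, p (π x)) (i : Fin n) : p i := by
  have h1 : ∀ᵐ i ∂(μ.map π), p i :=
    (ae_map_iff h.measurable.aemeasurable (Set.to_countable _).measurableSet).2 hp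
  exact ae_iff_of_countable.1 h1 i (by rw [h.map_singleton]; exact h.ne_zero)

end IsDiscretization

/-! ### Transfer along discretizations and the remaining cases -/

section transfer

variable {X' Y' : Type*} [MeasurableSpace X'] [MeasurableSpace Y']
  {μ : Measure X} {ν : Measure Y} {π : X → X'} {ρ : Y → Y'}
  {f : X → ℝ} {g : Y → ℝ} {f' : X' → ℝ} {g' : Y' → ℝ}

lemma SectionBound.map (h : SectionBound μ ν f g) (hπ : Measurable π) (hρ : Measurable ρ)
    (hf' : Measurable f') (hg' : Measurable g') (hf : f =ᵐ[μ] f' ∘ π) (hg : g =ᵐ[ν] g' ∘ ρ) :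
    SectionBound (μ.map π) (ν.map ρ) f' g' := by
  intro A B hA hB
  have h1 := h (π ⁻¹' A) (ρ ⁻¹' B) (hπ hA) (hρ hB)
  rw [Measure.map_apply hπ hA, Measure.map_apply hρ hB,
    setLIntegral_map hA hf'.ennreal_ofReal hπ, setLIntegral_map hB.compl hg'.ennreal_ofReal hρ]
  have e1 : ∫⁻ x in π ⁻¹' A, ENNReal.ofReal (f' (π x)) ∂μ =
      ∫⁻ x in π ⁻¹' A, ENNReal.ofReal (f x) ∂μ :=
    lintegral_congr_ae (ae_restrict_of_ae (hf.mono fun x hx => by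
      simp only [hx, Function.comp_apply]))
  have e2 : ∫⁻ y in ρ ⁻¹' Bᶜ, ENNReal.ofReal (g' (ρ y)) ∂ν =
      ∫⁻ y in (ρ ⁻¹' B)ᶜ, ENNReal.ofReal (g y) ∂ν :=
    lintegral_congr_ae (ae_restrict_of_ae (hg.mono fun x hx => by
      simp only [hx, Function.comp_apply]))
  rw [e1, e2]
  exact h1

lemma HasSectionSet.of_map (h : HasSectionSet (μ.map π) (ν.map ρ) f' g') (hπ : Measurable π)
    (hρ : Measurable ρ) (hf : f =ᵐ[μ] f' ∘ π) (hg : g =ᵐ[ν] g' ∘ ρ) :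
    HasSectionSet μ ν f g := by
  obtain ⟨E, hE, h1, h2⟩ := h
  have hind : Measurable (E.indicator fun _ => (1 : ℝ≥0∞)) := measurable_const.indicator hE
  refine ⟨Prod.map π ρ ⁻¹' E, hE.preimage (hπ.prodMap hρ), ?_, ?_⟩
  · filter_upwards [ae_of_ae_map hπ.aemeasurable h1, hf] with x hx hfx
    rw [hfx, Function.comp_apply, ← hx]
    exact (lintegral_map (hind.comp measurable_prodMk_left) hρ).symm
  · filter_upwards [ae_of_ae_map hρ.aemeasurable h2, hg] with y hy hgy
    rw [hgy, Function.comp_apply, ← hy]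
    exact (lintegral_map (hind.comp measurable_prodMk_right) hπ).symm

lemma HasSectionSet.swap (h : HasSectionSet ν μ g f) : HasSectionSet μ ν f g := by
  obtain ⟨E, hE, h1, h2⟩ := h
  exact ⟨Prod.swap ⁻¹' E, hE.preimage measurable_swap, h2, h1⟩

lemma hasSectionSet_of_measure_eq_zero (hμ : μ = 0)
    (hfg : ∫⁻ x, ENNReal.ofReal (f x) ∂μ = ∫⁻ y, ENNReal.ofReal (g y) ∂ν)
    (hg : Measurable g) : HasSectionSet μ ν f g := by
  subst hμ
  refine ⟨∅, .empty, by simp, ?_⟩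
  rw [lintegral_zero_measure, eq_comm, lintegral_eq_zero_iff hg.ennreal_ofReal] at hfg
  filter_upwards [hfg] with y hy
  simpa [horizSection] using hy.symm

variable [IsFiniteMeasure μ] [IsFiniteMeasure ν]

/-- All cases funnel through here: only the nullity of the fractional set depends on the type of the
measures. -/
lemma hasSectionSet_of_fractionalSet_null (h : SectionBound μ ν f g)
    (hf : Measurable f) (hg : Measurable g) (hf0 : ∀ x, 0 ≤ f x) (hg0 : ∀ y, 0 ≤ g y)
    (hfg : ∫⁻ x, ENNReal.ofReal (f x) ∂μ = ∫⁻ y, ENNReal.ofReal (g y) ∂ν)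
    (hnull : ∀ k, IsExtremalCoupling μ ν f g k → (μ.prod ν) (fractionalSet k) = 0) :
    HasSectionSet μ ν f g := by
  have hfin := h.lintegral_ne_top
  have hfi : Integrable f μ :=
    (lintegral_ofReal_ne_top_iff_integrable hf.aestronglyMeasurable (ae_of_all _ hf0)).1 hfin
  have hgi : Integrable g ν :=
    (lintegral_ofReal_ne_top_iff_integrable hg.aestronglyMeasurable (ae_of_all _ hg0)).1
      (hfg ▸ hfin)
  obtain ⟨k, hk⟩ := exists_extremalCoupling h hf hg hf0 hg0 hfi hgi (by
    rw [integral_eq_lintegral_of_nonneg_ae (ae_of_all _ hf0) hf.aestronglyMeasurable,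
      integral_eq_lintegral_of_nonneg_ae (ae_of_all _ hg0) hg.aestronglyMeasurable, hfg])
  exact hk.toIsCoupling.hasSectionSet (hnull k hk)

lemma hasSectionSet_of_map (h : SectionBound μ ν f g) (hπ : Measurable π) (hρ : Measurable ρ)
    (hfg : ∫⁻ x, ENNReal.ofReal (f x) ∂μ = ∫⁻ y, ENNReal.ofReal (g y) ∂ν)
    (hf : f =ᵐ[μ] f' ∘ π) (hg : g =ᵐ[ν] g' ∘ ρ)
    (hfm : Measurable f') (hgm : Measurable g') (hf0 : ∀ x, 0 ≤ f' x) (hg0 : ∀ y, 0 ≤ g' y)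
    (hnull : ∀ k, IsExtremalCoupling (μ.map π) (ν.map ρ) f' g' k →
      ((μ.map π).prod (ν.map ρ)) (fractionalSet k) = 0) :
    HasSectionSet μ ν f g := by
  refine (hasSectionSet_of_fractionalSet_null (h.map hπ hρ hfm hgm hf hg) hfm hgm hf0 hg0 ?_
    hnull).of_map hπ hρ hf hg
  rw [lintegral_map hfm.ennreal_ofReal hπ, lintegral_map hgm.ennreal_ofReal hρ]
  calc _ = ∫⁻ x, ENNReal.ofReal (f x) ∂μ :=
        lintegral_congr_ae (hf.mono fun x hx => by simp only [hx, Function.comp_apply])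
    _ = ∫⁻ y, ENNReal.ofReal (g y) ∂ν := hfg
    _ = _ := lintegral_congr_ae (hg.mono fun x hx => by simp only [hx, Function.comp_apply])

lemma hasSectionSet_of_nonatomic_of_equiatomic (h : SectionBound μ ν f g) (hμ : IsNonatomic μ)
    (hν : IsEquiatomic ν) (hν0 : ν ≠ 0)
    (hf : Measurable f) (hg : Measurable g) (hf0 : ∀ x, 0 ≤ f x) (hg0 : ∀ y, 0 ≤ g y)
    (hfg : ∫⁻ x, ENNReal.ofReal (f x) ∂μ = ∫⁻ y, ENNReal.ofReal (g y) ∂ν)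
    (hval : ∀ᵐ x ∂μ, IsMeasureValue ν (f x)) : HasSectionSet μ ν f g := by
  obtain ⟨n, ρ, c, hρ⟩ := hν.exists_isDiscretization hν0
  obtain ⟨g', hg'⟩ := hρ.factor g hg
  refine hasSectionSet_of_map (π := id) h measurable_id hρ.measurable hfg (ae_eq_refl f) hg' hf
    (measurable_of_finite g') hf0 (hρ.forall_of_ae ?_) fun k hk => ?_
  · filter_upwards [hg'] with y hy
    rw [← Function.comp_apply (f := g'), ← hy]
    exact hg0 y
  · refine hk.fractionalSet_null_of_nonatomic_fin (by rwa [Measure.map_id]) hρ.ne_zero hρ.ne_top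
      hρ.map_singleton ?_
    rw [Measure.map_id]
    exact hval.mono fun x hx => hρ.exists_eq_mul (hf0 x) hx

lemma hasSectionSet_of_equiatomic (h : SectionBound μ ν f g) (hμ : IsEquiatomic μ)
    (hν : IsEquiatomic ν) (hμ0 : μ ≠ 0) (hν0 : ν ≠ 0)
    (hf : Measurable f) (hg : Measurable g) (hf0 : ∀ x, 0 ≤ f x) (hg0 : ∀ y, 0 ≤ g y)
    (hfg : ∫⁻ x, ENNReal.ofReal (f x) ∂μ = ∫⁻ y, ENNReal.ofReal (g y) ∂ν)
    (hfval : ∀ᵐ x ∂μ, IsMeasureValue ν (f x)) (hgval : ∀ᵐ y ∂ν, IsMeasureValue μ (g y)) :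
    HasSectionSet μ ν f g := by
  obtain ⟨p, π, d, hπ⟩ := hμ.exists_isDiscretization hμ0
  obtain ⟨n, ρ, c, hρ⟩ := hν.exists_isDiscretization hν0
  obtain ⟨f', hf'⟩ := hπ.factor f hf
  obtain ⟨g', hg'⟩ := hρ.factor g hg
  refine hasSectionSet_of_map h hπ.measurable hρ.measurable hfg hf' hg' (measurable_of_finite f')
    (measurable_of_finite g') (hπ.forall_of_ae ?_) (hρ.forall_of_ae ?_) fun k hk => ?_
  · filter_upwards [hf'] with x hx
    rw [← Function.comp_apply (f := f'), ← hx]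
    exact hf0 x
  · filter_upwards [hg'] with y hy
    rw [← Function.comp_apply (f := g'), ← hy]
    exact hg0 y
  · refine hk.fractionalSet_null_of_fin hρ.ne_zero hρ.ne_top hπ.ne_zero hπ.ne_top
      hπ.map_singleton hρ.map_singleton
      (ae_of_all _ (hπ.forall_of_ae (p := fun i => ∃ m : ℕ, f' i = m * c.toReal) ?_))
      (ae_of_all _ (hρ.forall_of_ae (p := fun j => ∃ m : ℕ, g' j = m * d.toReal) ?_))
    · filter_upwards [hf', hfval] with x hx hv
      rw [← Function.comp_apply (f := f'), ← hx]
      exact hρ.exists_eq_mul (hf0 x) hv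
    · filter_upwards [hg', hgval] with y hy hv
      rw [← Function.comp_apply (f := g'), ← hy]
      exact hπ.exists_eq_mul (hg0 y) hv

end transfer

end Resonant

theorem theorem2 {X Y : Type*} [MeasurableSpace X] [MeasurableSpace Y]
    (μ : Measure X) (ν : Measure Y) [IsFiniteMeasure μ] [IsFiniteMeasure ν]
    (hμ : Resonant.IsResonant μ) (hν : Resonant.IsResonant ν)
    (f : X → ℝ) (g : Y → ℝ) (hf : Measurable f) (hg : Measurable g)
    (hf_nonneg : ∀ x, 0 ≤ f x) (hg_nonneg : ∀ y, 0 ≤ g y)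
    (hf_val : Resonant.IsEquiatomic ν → ∀ᵐ x ∂μ, Resonant.IsMeasureValue ν (f x))
    (hg_val : Resonant.IsEquiatomic μ → ∀ᵐ y ∂ν, Resonant.IsMeasureValue μ (g y))
    (hnorm : eLpNorm f 1 μ = eLpNorm g 1 ν)
    (hHLP : ∀ t : ℝ, 0 < t →
      ∫⁻ s in Set.Ioc 0 t, Resonant.rearrangement μ f s ≤
        ∫⁻ s in Set.Ioc 0 t, Resonant.distribution ν g s) :
    ∃ E : Set (X × Y), MeasurableSet E ∧
      (∀ᵐ x ∂μ, Resonant.vertSection ν E x = ENNReal.ofReal (f x)) ∧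
      (∀ᵐ y ∂ν, Resonant.horizSection μ E y = ENNReal.ofReal (g y)) := by
  have h := Resonant.sectionBound_of_rearrangement_le μ ν hf hg hf_nonneg hg_nonneg hHLP
  have hfg : ∫⁻ x, ENNReal.ofReal (f x) ∂μ = ∫⁻ y, ENNReal.ofReal (g y) ∂ν := by
    rw [eLpNorm_one_eq_lintegral_enorm, eLpNorm_one_eq_lintegral_enorm] at hnorm
    simpa only [Real.enorm_of_nonneg (hf_nonneg _), Real.enorm_of_nonneg (hg_nonneg _)] using hnorm
  change Resonant.HasSectionSet μ ν f g
  -- Zero measures are set aside because the discretization needs at least one atom.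
  by_cases hμ0 : μ = 0
  · exact Resonant.hasSectionSet_of_measure_eq_zero hμ0 hfg hg
  by_cases hν0 : ν = 0
  · exact (Resonant.hasSectionSet_of_measure_eq_zero hν0 hfg.symm hf).swap
  rcases hμ with hμ | hμ <;> rcases hν with hν | hν
  · exact Resonant.hasSectionSet_of_fractionalSet_null h hf hg hf_nonneg hg_nonneg hfg
      fun k hk => hk.fractionalSet_null_of_nonatomic hμ hν
  · exact Resonant.hasSectionSet_of_nonatomic_of_equiatomic h hμ hν hν0 hf hg hf_nonneg hg_nonneg
      hfg (hf_val hν)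
  -- The hypothesis on rearrangements is not symmetric in `f` and `g`, but the section inequality
  -- is, so the previous case applies with the factors exchanged.
  · exact (Resonant.hasSectionSet_of_nonatomic_of_equiatomic (h.symm hfg) hν hμ hμ0 hg hf
      hg_nonneg hf_nonneg hfg.symm (hg_val hμ)).swap
  · exact Resonant.hasSectionSet_of_equiatomic h hμ hν hμ0 hν0 hf hg hf_nonneg hg_nonneg hfg
      (hf_val hν) (hg_val hμ)
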